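/- Let $k\ge 2$ and let $H=P_{p_1}\cup\dots\cup P_{p_k}$ be the vertex-disjoint union of $k$ paths, where $P_m$ denotes the path with $m$ vertices and $p_i\ge 3$ for every $i$. Assume that $H\ne kP_3$, that is, at least one $p_i$ is different from $3$, and put $\ell=\sum_{i=1}^k\lfloor p_i/2\rfloor$. For a family $\mathscr F$ of graphs let $ex(n,\mathscr F)$ be the maximum number of edges of a simple graph on $n$ vertices that contains no member of $\mathscr F$ as a (not necessarily induced) subgraph. Then there is a number $n_0$, depending only on $H$, such that for every $n\ge n_0$ the following hold. (i) $ex(n,\{K_3,H\})=(n-\ell+1)(\ell-1)$. (ii) For every integer $r$ with $4\le r\le \ell+1$, $$ex(n,\{K_r,H\})=(n-\ell+1)(\ell-1)+e(T(\ell-1,r-2)),$$ where $e(T(m,s))$ is the number of edges of the Turán graph $T(m,s)$, the complete $s$-partite graph on $m$ vertices whose part sizes differ by at most one. (iii) For every integer $r\ge \ell+2$, $$ex(n,\{K_r,H\})=(n-\ell+1)(\ell-1)+\binom{\ell-1}{2}+D_H,$$ where $D_H=1$ if all $p_i$ are odd, and $D_H=0$ otherwise. -/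

import Mathlib

/-- The vertex-disjoint union of a family of simple graphs. -/
def disjointUnion {ι : Type} {V : ι → Type} (G : (i : ι) → SimpleGraph (V i)) :
    SimpleGraph ((i : ι) × V i) where
  Adj x y := ∃ (i : ι) (u v : V i), x = ⟨i, u⟩ ∧ y = ⟨i, v⟩ ∧ (G i).Adj u v
  symm := by
    constructor
    rintro _ _ ⟨i, u, v, rfl, rfl, h⟩
    exact ⟨i, v, u, rfl, rfl, h.symm⟩
  loopless := by
    constructor
    rintro _ ⟨i, u, v, rfl, h₂, h⟩
    cases h₂
    exact h.ne rfl

/-- The linear forest whose components are paths with `p 0, …, p (k - 1)` vertices. -/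
def linearForest {k : ℕ} (p : Fin k → ℕ) : SimpleGraph ((i : Fin k) × Fin (p i)) :=
  disjointUnion fun i => SimpleGraph.pathGraph (p i)

open scoped Classical in
/-- The Turán number of a family of graphs: the maximum number of edges of a simple graph on `n`
vertices that contains no member of the family as a (not necessarily induced) subgraph.
If every graph on `n` vertices contains a member of the family, the value is `0`; this does not
happen when every member has an edge. -/
noncomputable def turanNumber (n : ℕ) (𝓕 : Set ((W : Type) × SimpleGraph W)) : ℕ :=
  Finset.sup {G : SimpleGraph (Fin n) | ∀ F ∈ 𝓕, F.2.Free G} fun G => G.edgeFinset.card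

/-! Put `L = ℓ - 1`. In a copy of `H`, every vertex cover contains at least `p i / 2` vertices of
the `i`-th path, hence at least `ℓ` vertices. So the join of any graph on `L` vertices with an
edgeless graph is `H`-free. If all `p i` are odd this survives one extra edge on the edgeless side,
because a path on `2q + 1` vertices minus one edge still has `q` disjoint edges. The Turán graph, or
`K_L` when `r` is large, then gives the lower bounds.

For the upper bound let `G` be `H`-free with at least `L (n - L)` edges. It cannot be peeled down by
removing bounded sets that meet fewer than `L` edges per vertex, so some large `S` has no such part.
As `G` has no path on `∑ p i` vertices, `S` contains a fan: many disjoint bounded sets attached to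
the rest of `S` through boundedly many vertices. By pigeonhole many of them have the same
attachment. If it has at least `L` vertices, these include `L` vertices with many common neighbours.
Otherwise the missing edges lie inside the pieces, Erdős–Gallai gives paths there, and these prolong
alternating paths enough to build `H` (`exists_common_neighbours`).

Let `A` be such a set of `L` vertices. A path on `p i` vertices with fewer than `p i / 2` of them in
`A` would complete to a copy of `H`. Forbidding such paths leaves at most `L (n - L) + e(G[A])`
edges, plus possibly one, and the extra one occurs only if all `p i` are odd and an edge is joined
completely to `A`. A common neighbour lowers the clique number available to `A` by one, so Turán's
theorem bounds `e(G[A])`. An exceptional edge lowers it by two, and the strict Turán inequality pays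
for that edge (`exists_card_edgeFinset_le`). -/

section LinearForestTuran

open scoped Classical

/-! ### Counting adjacent ordered pairs between vertex sets -/

section Count

variable {V : Type*} (G : SimpleGraph V)

/-- The number of neighbours of `x` in `Y`. -/
noncomputable def degIn (x : V) (Y : Finset V) : ℕ := (Y.filter (G.Adj x)).card

/-- The number of pairs `(x, y) ∈ X × Y` of adjacent vertices; edges inside `X ∩ Y` count twice. -/
noncomputable def adjCount (X Y : Finset V) : ℕ := ∑ x ∈ X, degIn G x Y

variable {G}

theorem degIn_le_card (x : V) (Y : Finset V) : degIn G x Y ≤ Y.card :=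
  Finset.card_filter_le _ _

theorem degIn_union (x : V) {Y Z : Finset V} (h : Disjoint Y Z) :
    degIn G x (Y ∪ Z) = degIn G x Y + degIn G x Z := by
  rw [degIn, Finset.filter_union, Finset.card_union_of_disjoint
    (Finset.disjoint_filter_filter h)]
  rfl

theorem degIn_eq_zero {x : V} {Y : Finset V} : degIn G x Y = 0 ↔ ∀ y ∈ Y, ¬ G.Adj x y := by
  simp [degIn, Finset.filter_eq_empty_iff]

theorem adjCount_comm (X Y : Finset V) : adjCount G X Y = adjCount G Y X := by
  have := Finset.sum_card_bipartiteAbove_eq_sum_card_bipartiteBelow G.Adj (s := X) (t := Y)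
  simp only [Finset.bipartiteAbove, Finset.bipartiteBelow] at this
  simp only [adjCount, degIn, this]
  refine Finset.sum_congr rfl fun y _ => ?_
  congr 1
  ext x
  simp [G.adj_comm]

theorem adjCount_union_left {X Y : Finset V} (Z : Finset V) (h : Disjoint X Y) :
    adjCount G (X ∪ Y) Z = adjCount G X Z + adjCount G Y Z :=
  Finset.sum_union h

theorem adjCount_union_right {X Y : Finset V} (Z : Finset V) (h : Disjoint X Y) :
    adjCount G Z (X ∪ Y) = adjCount G Z X + adjCount G Z Y := by
  rw [adjCount_comm, adjCount_union_left Z h, adjCount_comm X, adjCount_comm Y]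

theorem adjCount_union_self {X Y : Finset V} (h : Disjoint X Y) :
    adjCount G (X ∪ Y) (X ∪ Y) = adjCount G X X + 2 * adjCount G X Y + adjCount G Y Y := by
  rw [adjCount_union_left _ h, adjCount_union_right _ h, adjCount_union_right _ h,
    adjCount_comm Y X]
  ring

theorem adjCount_sdiff_self {X S : Finset V} (h : X ⊆ S) :
    adjCount G S S = adjCount G X X + 2 * adjCount G X (S \ X) + adjCount G (S \ X) (S \ X) := by
  rw [← adjCount_union_self Finset.disjoint_sdiff, Finset.union_sdiff_of_subset h]

theorem adjCount_singleton (x : V) (Y : Finset V) : adjCount G {x} Y = degIn G x Y := by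
  simp [adjCount]

theorem degIn_erase_self (x : V) (S : Finset V) : degIn G x (S.erase x) = degIn G x S := by
  unfold degIn
  congr 1
  ext y
  simp only [Finset.mem_filter, Finset.mem_erase]
  exact ⟨fun h => ⟨h.1.2, h.2⟩, fun h => ⟨⟨h.2.ne', h.1⟩, h.2⟩⟩

theorem degIn_self_lt {x : V} {S : Finset V} (hx : x ∈ S) : degIn G x S < S.card := by
  rw [← degIn_erase_self]
  exact (degIn_le_card _ _).trans_lt (Finset.card_erase_lt_of_mem hx)

theorem adjCount_erase {x : V} {S : Finset V} (hx : x ∈ S) :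
    adjCount G S S = 2 * degIn G x S + adjCount G (S.erase x) (S.erase x) := by
  rw [adjCount_sdiff_self (Finset.singleton_subset_iff.2 hx), adjCount_singleton,
    adjCount_singleton, Finset.sdiff_singleton_eq_erase, degIn_erase_self]
  simp [degIn, Finset.filter_singleton]

theorem adjCount_self_le (S : Finset V) : adjCount G S S ≤ S.card * (S.card - 1) := by
  rw [adjCount, ← smul_eq_mul]
  exact Finset.sum_le_card_nsmul _ _ _ fun x hx => Nat.le_sub_one_of_lt (degIn_self_lt hx)

theorem adjCount_eq_zero {X Y : Finset V} (h : ∀ x ∈ X, ∀ y ∈ Y, ¬ G.Adj x y) :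
    adjCount G X Y = 0 :=
  Finset.sum_eq_zero fun x hx => degIn_eq_zero.2 (h x hx)

theorem adjCount_univ [Fintype V] [Fintype G.edgeSet] :
    adjCount G Finset.univ Finset.univ = 2 * G.edgeFinset.card := by
  have h := G.sum_degrees_eq_twice_card_edges
  rw [show 2 * G.edgeFinset.card = ∑ v, G.degree v by convert h.symm]
  refine Finset.sum_congr rfl fun x _ => ?_
  rw [degIn, ← G.card_neighborFinset_eq_degree, G.neighborFinset_eq_filter]

end Count

/-! ### Paths as lists, rotations and the Erdős–Gallai theorem -/

section Paths

variable {V : Type*}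

/-- The list of the vertices of a path of `G`, in order. -/
def IsPathList (G : SimpleGraph V) (l : List V) : Prop := l.IsChain G.Adj ∧ l.Nodup

variable {G : SimpleGraph V}

theorem IsPathList.take {l : List V} (h : IsPathList G l) (n : ℕ) : IsPathList G (l.take n) :=
  ⟨h.1.take n, h.2.sublist (List.take_sublist n l)⟩

theorem IsPathList.reverse {l : List V} (h : IsPathList G l) : IsPathList G l.reverse := by
  refine ⟨?_, List.nodup_reverse.2 h.2⟩
  rw [List.isChain_reverse]
  exact h.1.imp fun _ _ h => h.symm

theorem isPathList_cons {v : V} {l : List V} :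
    IsPathList G (v :: l) ↔ (∀ y ∈ l.head?, G.Adj v y) ∧ v ∉ l ∧ IsPathList G l := by
  rw [IsPathList, IsPathList, List.isChain_cons, List.nodup_cons]
  tauto

theorem IsPathList.append {l₁ l₂ : List V} (h₁ : IsPathList G l₁) (h₂ : IsPathList G l₂)
    (hd : ∀ x ∈ l₁, x ∉ l₂) (h : ∀ x ∈ l₁.getLast?, ∀ y ∈ l₂.head?, G.Adj x y) :
    IsPathList G (l₁ ++ l₂) :=
  ⟨List.isChain_append.2 ⟨h₁.1, h₂.1, h⟩,
    List.nodup_append.2 ⟨h₁.2, h₂.2, fun a ha _ hb hab => hd a ha (hab ▸ hb)⟩⟩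

/-- In a set where every vertex has at least `m` neighbours, a path on `m + 1` vertices starts
at every vertex. -/
theorem exists_isPathList_head {Q : Finset V} {m : ℕ} (hQ : ∀ x ∈ Q, m ≤ degIn G x Q) {v : V}
    (hv : v ∈ Q) :
    ∃ l, IsPathList G (v :: l) ∧ (∀ x ∈ v :: l, x ∈ Q) ∧ (v :: l).length = m + 1 := by
  -- The path grows at its front, so `v` stays its last vertex; reversing it at the end puts `v`
  -- first.
  have key : ∀ n ≤ m, ∃ w l, IsPathList G (w :: l) ∧ (∀ x ∈ w :: l, x ∈ Q) ∧
      (w :: l).length = n + 1 ∧ (w :: l).getLast? = some v := by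
    intro n
    induction n with
    | zero => exact fun _ => ⟨v, [], ⟨by simp, by simp⟩, by simpa using hv, rfl, rfl⟩
    | succ n ih =>
      intro hn
      obtain ⟨w, l, hp, hl, hlen, hlast⟩ := ih (by omega)
      have hex : ∃ y ∈ Q.filter (G.Adj w), y ∉ l.toFinset := by
        by_contra! hcon
        have h1 := Finset.card_le_card (show Q.filter (G.Adj w) ⊆ l.toFinset from hcon)
        have h2 := hQ w (hl w (by simp))
        have h3 := l.toFinset_card_le
        simp only [degIn] at h2
        simp only [List.length_cons] at hlen
        omega
      obtain ⟨y, hy, hyl⟩ := hex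
      rw [Finset.mem_filter] at hy
      refine ⟨y, w :: l, isPathList_cons.2 ⟨?_, ?_, hp⟩, ?_, by simp_all, ?_⟩
      · simpa using hy.2.symm
      · simp only [List.mem_cons, not_or]
        exact ⟨hy.2.ne', by simpa using hyl⟩
      · intro x hx
        rcases List.mem_cons.1 hx with rfl | hx
        exacts [hy.1, hl x hx]
      · rw [List.getLast?_cons_cons, hlast]
  obtain ⟨w, l, hp, hl, hlen, hlast⟩ := key m le_rfl
  have hr : (w :: l).reverse.head? = some v := by rw [List.head?_reverse, hlast]
  obtain ⟨t, ht⟩ := List.head?_eq_some_iff.1 hr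
  refine ⟨t, ht ▸ hp.reverse, ?_, ?_⟩
  · rw [← ht]; exact fun x hx => hl x (List.mem_reverse.1 hx)
  · rw [← ht, List.length_reverse, hlen]

/-- If the ends of a path have many neighbours on the path, then every vertex of the path is the
first vertex of a path with the same vertices. -/
theorem IsPathList.exists_rotate {l : List V} (hl : IsPathList G l) {x y : V}
    (hx : l.head? = some x) (hy : l.getLast? = some y)
    (hdeg : l.length ≤ degIn G x l.toFinset + degIn G y l.toFinset) {z : V} (hz : z ∈ l) :
    ∃ t, IsPathList G (z :: t) ∧ (z :: t).Perm l := by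
  obtain ⟨s, hs⟩ : ∃ s, l.length = s + 1 := by
    cases l with
    | nil => simp at hx
    | cons a t => exact ⟨t.length, rfl⟩
  have hx0 : l[0] = x := by
    rw [List.head?_eq_getElem?, List.getElem?_eq_some_iff] at hx
    exact hx.2
  have hys : l[s] = y := by
    rw [List.getLast?_eq_getElem?, List.getElem?_eq_some_iff] at hy
    obtain ⟨h, hy⟩ := hy
    simpa [hs] using hy
  set f : ℕ → V := fun i => l.getD i x with hf
  have hfe : ∀ i (h : i < l.length), f i = l[i] := fun i h => by
    simp [hf, List.getD_eq_getElem?_getD, List.getElem?_eq_getElem h]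
  -- Pósa's crossing argument: `|I| + |J| ≥ s + 1` inside a range of size `s`, so some `i` has `x`
  -- adjacent to vertex `i + 1` and `y` adjacent to vertex `i`. These two chords close the path into
  -- a spanning cycle.
  set I := (Finset.range s).filter (fun i => G.Adj x (f (i + 1))) with hI
  set J := (Finset.range s).filter (fun i => G.Adj y (f i)) with hJ
  have hIc : degIn G x l.toFinset ≤ I.card := by
    refine (Finset.card_le_card (t := I.image fun i => f (i + 1)) ?_).trans Finset.card_image_le
    intro u hu
    rw [Finset.mem_filter, List.mem_toFinset] at hu
    obtain ⟨i, hi, rfl⟩ := List.getElem_of_mem hu.1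
    obtain rfl | ⟨i, rfl⟩ : i = 0 ∨ ∃ j, i = j + 1 := by
      cases i <;> simp
    · exact absurd (hx0 ▸ hu.2) (G.irrefl)
    · refine Finset.mem_image.2 ⟨i, ?_, hfe _ hi⟩
      rw [hI, Finset.mem_filter, Finset.mem_range, hfe _ hi]
      exact ⟨by omega, hu.2⟩
  have hJc : degIn G y l.toFinset ≤ J.card := by
    refine (Finset.card_le_card (t := J.image f) ?_).trans Finset.card_image_le
    intro u hu
    rw [Finset.mem_filter, List.mem_toFinset] at hu
    obtain ⟨i, hi, rfl⟩ := List.getElem_of_mem hu.1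
    obtain rfl | hne := eq_or_ne i s
    · exact absurd (hys ▸ hu.2) (G.irrefl)
    · refine Finset.mem_image.2 ⟨i, ?_, hfe _ hi⟩
      rw [hJ, Finset.mem_filter, Finset.mem_range, hfe _ hi]
      exact ⟨by omega, hu.2⟩
  have hIJ : (I ∩ J).Nonempty := by
    rw [Finset.nonempty_iff_ne_empty]
    intro h0
    have h1 := Finset.card_union_of_disjoint (Finset.disjoint_iff_inter_eq_empty.2 h0)
    have h2 : (I ∪ J).card ≤ s := by
      rw [← Finset.card_range s]
      exact Finset.card_le_card (Finset.union_subset (Finset.filter_subset _ _)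
        (Finset.filter_subset _ _))
    omega
  obtain ⟨i, hi⟩ := hIJ
  rw [Finset.mem_inter, hI, hJ, Finset.mem_filter, Finset.mem_filter, Finset.mem_range] at hi
  obtain ⟨⟨his, hxi⟩, -, hyi⟩ := hi
  rw [hfe _ (by omega)] at hxi hyi
  -- the vertices of the path in a cyclic order
  set c := (l.take (i + 1)).reverse ++ l.drop (i + 1) with hc
  have hperm : c.Perm l := by
    calc c.Perm (l.take (i + 1) ++ l.drop (i + 1)) :=
          (List.reverse_perm _).append_right _
      _ = l := List.take_append_drop _ _
  have hcp : IsPathList G c := by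
    refine ⟨List.isChain_append.2 ⟨(hl.take _).reverse.1, hl.1.drop _, ?_⟩,
      hperm.nodup_iff.2 hl.2⟩
    intro u hu v hv
    rw [List.getLast?_reverse, List.head?_take, if_neg (by omega), hx, Option.mem_some_iff] at hu
    rw [List.head?_drop, List.getElem?_eq_getElem (by omega), Option.mem_some_iff] at hv
    rw [← hu, ← hv]
    exact hxi
  have hhead : c.head? = some l[i] := by
    rw [hc, List.head?_append, List.head?_reverse, List.getLast?_take, if_neg (by omega)]
    simp [List.getElem?_eq_getElem (show i < l.length by omega)]
  have hlast : c.getLast? = some y := by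
    rw [hc, List.getLast?_append, List.getLast?_drop, if_neg (by omega), hy]
    rfl
  -- The last vertex `y` of `c` is adjacent to its first vertex, so `c` is a cycle and may be cut
  -- just before `z`.
  obtain ⟨c₁, c₂, hcc⟩ := List.append_of_mem (hperm.mem_iff.2 hz)
  rw [hcc] at hcp hperm hhead hlast
  have hp2 : ((z :: c₂) ++ c₁).Perm l := List.perm_append_comm.trans hperm
  refine ⟨c₂ ++ c₁, ⟨?_, hp2.nodup_iff.2 hl.2⟩, hp2⟩
  obtain ⟨h1, h2, -⟩ := List.isChain_append.1 hcp.1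
  rw [← List.cons_append]
  refine List.isChain_append.2 ⟨h2, h1, ?_⟩
  intro u hu v hv
  rw [List.getLast?_append] at hlast
  rw [List.head?_append] at hhead
  rw [Option.mem_def] at hu hv
  rw [hu] at hlast
  rw [hv] at hhead
  simp only [Option.some_or, Option.some.injEq] at hlast hhead
  rw [hlast, hhead]
  exact hyi

/-- A form of the Erdős–Gallai theorem: at least `m |Q| > 0` edges force a path on `2m + 1`
vertices. -/
theorem exists_isPathList_of_adjCount {m : ℕ} (hm : 1 ≤ m) (Q : Finset V) (hQ : Q.Nonempty)
    (h : 2 * m * Q.card ≤ adjCount G Q Q) :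
    ∃ l, IsPathList G l ∧ (∀ x ∈ l, x ∈ Q) ∧ l.length = 2 * m + 1 := by
  induction Q using Finset.strongInduction with
  | H Q ih =>
  by_contra hcon
  have hsub : ∀ R ⊂ Q, R.Nonempty → adjCount G R R < 2 * m * R.card := by
    intro R hR hRn
    by_contra! hle
    obtain ⟨l, h1, h2, h3⟩ := ih R hR hRn hle
    exact hcon ⟨l, h1, fun x hx => hR.1 (h2 x hx), h3⟩
  -- Deleting a vertex of degree at most `m` would preserve the edge hypothesis on a smaller set.
  have hdeg : ∀ v ∈ Q, m + 1 ≤ degIn G v Q := by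
    intro v hv
    by_contra! hlt
    have h1 := adjCount_erase (G := G) hv
    have h2 := Finset.card_erase_add_one hv
    rcases (Q.erase v).eq_empty_or_nonempty with h0 | hne
    · rw [h0] at h1 h2
      have : degIn G v Q < Q.card := degIn_self_lt hv
      simp only [Finset.card_empty] at h2
      have h3 : adjCount G (∅ : Finset V) ∅ = 0 := by simp [adjCount]
      rw [← h2] at this h
      omega
    · have h3 := hsub _ (Finset.erase_ssubset hv) hne
      rw [← h2, mul_add] at h
      omega
  have hshort : ∀ l, IsPathList G l → (∀ x ∈ l, x ∈ Q) → l.length ≤ 2 * m := by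
    intro l hl hlQ
    by_contra! hlt
    exact hcon ⟨l.take (2 * m + 1), hl.take _, fun x hx => hlQ x (List.mem_of_mem_take hx), by
      rw [List.length_take]; omega⟩
  obtain ⟨v₀, hv₀⟩ := hQ
  obtain ⟨l, ⟨hl, hlQ⟩, hmax⟩ : ∃ l, (IsPathList G l ∧ ∀ x ∈ l, x ∈ Q) ∧
      ∀ l', IsPathList G l' → (∀ x ∈ l', x ∈ Q) → l'.length ≤ l.length := by
    let P : ℕ → Prop := fun n => ∃ l, IsPathList G l ∧ (∀ x ∈ l, x ∈ Q) ∧ l.length = n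
    have hP : P (Nat.findGreatest P (2 * m)) :=
      Nat.findGreatest_spec (m := 0) (Nat.zero_le _) ⟨[], ⟨by simp, by simp⟩, by simp, rfl⟩
    obtain ⟨l, h1, h2, h3⟩ := hP
    exact ⟨l, ⟨h1, h2⟩, fun l' h1' h2' => h3 ▸
      Nat.le_findGreatest (hshort l' h1' h2') ⟨l', h1', h2', rfl⟩⟩
  have hone := hmax [v₀] ⟨by simp, by simp⟩ (by simpa using hv₀)
  have hne : l ≠ [] := by
    rintro rfl
    simp at hone
  have hext : ∀ z t, IsPathList G (z :: t) → (z :: t).Perm l → ∀ w ∈ Q, G.Adj z w → w ∈ l := by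
    intro z t hzt hperm w hw hzw
    by_contra hwl
    have := hmax (w :: z :: t) (isPathList_cons.2 ⟨by simpa using hzw.symm,
      fun h => hwl (hperm.mem_iff.1 h), hzt⟩) (by
        intro x hx
        rcases List.mem_cons.1 hx with rfl | hx
        exacts [hw, hlQ x (hperm.mem_iff.1 hx)])
    rw [List.length_cons, hperm.length_eq] at this
    omega
  have hfull : ∀ z t, IsPathList G (z :: t) → (z :: t).Perm l → m + 1 ≤ degIn G z l.toFinset := by
    intro z t hzt hperm
    refine (hdeg z (hlQ z (hperm.mem_iff.1 (by simp)))).trans (Finset.card_le_card ?_)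
    intro w hw
    rw [Finset.mem_filter] at hw ⊢
    exact ⟨List.mem_toFinset.2 (hext z t hzt hperm w hw.1 hw.2), hw.2⟩
  obtain ⟨x, t, rfl⟩ := List.exists_cons_of_ne_nil hne
  obtain ⟨y, t', hyt⟩ := List.exists_cons_of_ne_nil (List.reverse_ne_nil_iff.2 hne)
  have hyp : (y :: t').Perm (x :: t) := hyt ▸ List.reverse_perm _
  have hlast : (x :: t).getLast? = some y := by
    rw [← List.head?_reverse, hyt]; rfl
  -- The ends of a longest path have degree sum at least `2m + 2` on it, so every vertex of it can
  -- be made an end; by maximality no edge leaves the path.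
  have hclosed : ∀ z ∈ x :: t, ∀ w ∈ Q, G.Adj z w → w ∈ x :: t := by
    intro z hz w hw hzw
    have h1 := hfull x t hl (List.Perm.refl _)
    have h2 := hfull y t' (hyt ▸ hl.reverse) hyp
    have h3 := hshort _ hl hlQ
    obtain ⟨s, hs, hsp⟩ := hl.exists_rotate rfl hlast (by omega) hz
    exact hext z s hs hsp w hw hzw
  set Z := (x :: t).toFinset with hZ
  have hZQ : Z ⊆ Q := fun u hu => hlQ u (List.mem_toFinset.1 hu)
  have hZc : Z.card ≤ 2 * m := (List.toFinset_card_le _).trans (hshort _ hl hlQ)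
  have hZpos : 0 < Z.card := Finset.card_pos.2 ⟨x, by simp [hZ]⟩
  have h1 := adjCount_sdiff_self (G := G) hZQ
  have h2 : adjCount G Z (Q \ Z) = 0 := adjCount_eq_zero fun z hz w hw hzw => by
    rw [Finset.mem_sdiff] at hw
    exact hw.2 (List.mem_toFinset.2 (hclosed z (List.mem_toFinset.1 hz) w hw.1 hzw))
  -- A component on at most `2m` vertices has fewer than `m |Z|` edges, so its complement in `Q`
  -- would still satisfy the hypothesis.
  have h3 : adjCount G Z Z < 2 * m * Z.card := by
    refine (adjCount_self_le Z).trans_lt ?_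
    rw [mul_comm]
    exact Nat.mul_lt_mul_of_pos_right (by omega) hZpos
  have h4 := Finset.card_sdiff_add_card_eq_card hZQ
  rw [← h4, mul_add] at h
  rcases (Q \ Z).eq_empty_or_nonempty with h0 | hne
  · rw [h0] at h h1 h2
    have h5 : adjCount G (∅ : Finset V) ∅ = 0 := by simp [adjCount]
    simp only [Finset.card_empty] at h
    omega
  · have := hsub (Q \ Z) ⟨Finset.sdiff_subset, fun hss => by
      have := hss (hZQ (show x ∈ Z by simp [hZ]))
      simp [hZ] at this⟩ hne
    omega

end Paths

/-! ### Large sets without long paths contain fans -/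

section Fans

variable {V : Type*} {G : SimpleGraph V}

/-- `K` induces a connected subgraph. -/
def IsIndecomposable (G : SimpleGraph V) (K : Finset V) : Prop :=
  K.Nonempty ∧ ∀ R ⊂ K, R.Nonempty → ∃ x ∈ R, ∃ y ∈ K \ R, G.Adj x y

/-- `K` is a union of components of the subgraph induced on `S`. -/
def IsClosedIn (G : SimpleGraph V) (K S : Finset V) : Prop :=
  K ⊆ S ∧ ∀ x ∈ K, ∀ y ∈ S, G.Adj x y → y ∈ K

theorem exists_isIndecomposable {S : Finset V} (hS : S.Nonempty) :
    ∃ K, IsIndecomposable G K ∧ IsClosedIn G K S := by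
  induction S using Finset.strongInduction with
  | H S ih =>
  by_cases h : IsIndecomposable G S
  · exact ⟨S, h, subset_rfl, fun _ _ _ hy _ => hy⟩
  · simp only [IsIndecomposable, not_and, not_forall] at h
    obtain ⟨R, hRS, hR, hno⟩ := h hS
    push Not at hno
    obtain ⟨K, hK, hKR, hcl⟩ := ih R hRS hR
    refine ⟨K, hK, hKR.trans hRS.1, fun x hx y hy hxy => hcl x hx y ?_ hxy⟩
    by_contra hyR
    exact hno x (hKR hx) y (Finset.mem_sdiff.2 ⟨hy, hyR⟩) hxy

/-- `M` disjoint nonempty sets of size at most `t`, each without edges to the rest of `S`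
apart from those to a common set of size at most `N`. -/
def HasFan (G : SimpleGraph V) (M N t : ℕ) (S : Finset V) : Prop :=
  ∃ T : Finset V, T.card ≤ N ∧ ∃ Q : Fin M → Finset V, Pairwise (fun i j => Disjoint (Q i) (Q j)) ∧
    ∀ j, (Q j).Nonempty ∧ (Q j).card ≤ t ∧ Q j ⊆ S ∧ Disjoint (Q j) T ∧
      ∀ x ∈ Q j, ∀ y ∈ S, G.Adj x y → y ∈ Q j ∨ y ∈ T

/-- Passes from a part `K` to `S`: the edges leaving `K` end in `U`, which is added to the
attachment set. -/
theorem HasFan.extend {M N t N' t' : ℕ} {K S U : Finset V} (h : HasFan G M N t K) (hKS : K ⊆ S)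
    (hU : N + U.card ≤ N') (ht : t ≤ t') (hdisj : Disjoint K U)
    (hcl : ∀ x ∈ K, ∀ y ∈ S, G.Adj x y → y ∈ K ∨ y ∈ U) : HasFan G M N' t' S := by
  obtain ⟨T, hT, Q, hQ, h⟩ := h
  refine ⟨T ∪ U, (Finset.card_union_le _ _).trans (by omega), Q, hQ, fun j => ?_⟩
  obtain ⟨h1, h2, h3, h4, h5⟩ := h j
  refine ⟨h1, h2.trans ht, h3.trans hKS, ?_, fun x hx y hy hxy => ?_⟩
  · exact Finset.disjoint_union_right.2 ⟨h4, hdisj.mono_left h3⟩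
  · rcases hcl x (h3 hx) y hy hxy with hyK | hyU
    · rcases h5 x hx y hyK hxy with h | h
      · exact Or.inl h
      · exact Or.inr (Finset.mem_union_left _ h)
    · exact Or.inr (Finset.mem_union_right _ hyU)

theorem hasFan_of_small_components {t : ℕ} (M : ℕ) (S : Finset V)
    (hS : ∀ K, IsIndecomposable G K → IsClosedIn G K S → K.card ≤ t) (hM : M * t < S.card) :
    HasFan G M 0 t S := by
  induction M generalizing S with
  | zero => exact ⟨∅, le_rfl, fun j => j.elim0, fun j => j.elim0, fun j => j.elim0⟩
  | succ M ih =>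
    obtain ⟨K, hK, hKS, hcl⟩ := exists_isIndecomposable (G := G)
      (Finset.card_pos.1 (by omega : 0 < S.card))
    have hKt := hS K hK ⟨hKS, hcl⟩
    have hcl' : ∀ x ∈ S \ K, ∀ y ∈ S, G.Adj x y → y ∈ S \ K := by
      intro x hx y hy hxy
      rw [Finset.mem_sdiff] at hx ⊢
      exact ⟨hy, fun hyK => hx.2 (hcl y hyK x hx.1 hxy.symm)⟩
    have hcard := Finset.card_sdiff_add_card_eq_card hKS
    obtain ⟨T, hT, Q, hQ, h⟩ := ih (S \ K) (by
      intro L hL hLS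
      refine hS L hL ⟨hLS.1.trans Finset.sdiff_subset, fun x hx y hy hxy =>
        hLS.2 x hx y (hcl' x (hLS.1 hx) y hy hxy) hxy⟩) (by rw [add_mul] at hM; omega)
    have hT0 : T = ∅ := Finset.card_eq_zero.1 (Nat.le_zero.1 hT)
    subst hT0
    refine ⟨∅, le_rfl, Fin.cons K Q, ?_, ?_⟩
    · have hd : ∀ j, Disjoint K (Q j) := fun j =>
        Finset.disjoint_sdiff.mono_right (h j).2.2.1
      intro i j
      refine Fin.cases ?_ (fun i => ?_) i <;> refine Fin.cases ?_ (fun j => ?_) j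
      · simp
      · intro _; simpa using hd j
      · intro _; simpa using (hd i).symm
      · intro hij
        simpa using hQ (i := i) (j := j) (fun h => hij (by rw [h]))
    · intro j
      refine Fin.cases ?_ (fun j => ?_) j
      · exact ⟨hK.1, hKt, hKS, by simp, fun x hx y hy hxy => Or.inl (hcl x hx y hy hxy)⟩
      · obtain ⟨h1, h2, h3, h4, h5⟩ := h j
        exact ⟨h1, h2, h3.trans Finset.sdiff_subset, h4, fun x hx y hy hxy =>
          h5 x hx y (hcl' x (h3 hx) y hy hxy) hxy⟩

/-- A bound for the size of a connected set without fans in which no path on `N` vertices starts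
at a given vertex. -/
def fanBound (M : ℕ) : ℕ → ℕ
  | 0 => 0
  | N + 1 => (M + 1) * fanBound M N + 1

theorem fanBound_le_succ (M N : ℕ) : fanBound M N ≤ fanBound M (N + 1) := by
  rw [fanBound, add_mul]
  omega

/-- Delete `u`. If all components left are small, they are either few, which bounds `S`, or many,
and form a fan attached to `u`. A large component contains a neighbour `w` of `u`; paths from `w`
inside it are one vertex shorter, so induction gives a fan there, and `u` joins its attachment set.
The extra summand in `fanBound` only makes it monotone. -/
theorem card_le_or_hasFan_of_rooted (M N : ℕ) (S : Finset V) (hS : IsIndecomposable G S) {u : V}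
    (hu : u ∈ S)
    (hN : ∀ l, IsPathList G (u :: l) → (∀ x ∈ u :: l, x ∈ S) → l.length ≠ N) :
    S.card ≤ fanBound M N ∨ HasFan G M N (fanBound M N) S := by
  induction N generalizing S u with
  | zero => exact absurd rfl (hN [] ⟨by simp, by simp⟩ (by simpa using hu))
  | succ N ih =>
    have herase : ∀ K, K ⊆ S.erase u → (∀ x ∈ K, ∀ y ∈ S.erase u, G.Adj x y → y ∈ K) →
        ∀ x ∈ K, ∀ y ∈ S, G.Adj x y → y ∈ K ∨ y ∈ ({u} : Finset V) := by
      intro K hK hcl x hx y hy hxy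
      by_cases hyu : y = u
      · exact Or.inr (by simpa using hyu)
      · exact Or.inl (hcl x hx y (Finset.mem_erase.2 ⟨hyu, hy⟩) hxy)
    by_cases hbig : ∃ K, IsIndecomposable G K ∧ IsClosedIn G K (S.erase u) ∧ fanBound M N < K.card
    · obtain ⟨K, hK, ⟨hKS, hcl⟩, hKc⟩ := hbig
      have huK : u ∉ K := fun h => by simpa using hKS h
      have hKS' : K ⊆ S := hKS.trans (Finset.erase_subset _ _)
      -- Connectedness of `S` gives an edge leaving `K`; as `K` is a component of `S` without `u`,
      -- that edge ends at `u`.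
      obtain ⟨w, hwK, y, hy, hwy⟩ := hS.2 K ⟨hKS', fun h => huK (h hu)⟩ hK.1
      rw [Finset.mem_sdiff] at hy
      have hyu : y = u := by
        simpa [hy.2] using herase K hKS hcl w hwK y hy.1 hwy
      subst hyu
      have hfan := (ih K hK hwK fun l hl hlK hlen => hN (w :: l)
        (isPathList_cons.2 ⟨by simpa using hwy.symm, fun h => huK (hlK _ h), hl⟩)
        (by
          intro x hx
          rcases List.mem_cons.1 hx with rfl | hx
          exacts [hu, hKS' (hlK x hx)]) (by rw [List.length_cons, hlen])).resolve_left (by omega)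
      exact Or.inr (hfan.extend hKS' (by simp) (fanBound_le_succ M N) (by simpa using huK)
        (herase K hKS hcl))
    · push Not at hbig
      by_cases hM : M * fanBound M N < (S.erase u).card
      · refine Or.inr ((hasFan_of_small_components M (S.erase u) hbig hM).extend
          (Finset.erase_subset _ _) (U := {u}) (by simp) (fanBound_le_succ M N) (by simp)
          (herase _ subset_rfl fun _ _ _ hy _ => hy))
      · left
        have := Finset.card_erase_add_one hu
        rw [fanBound, add_mul]
        omega

theorem card_le_or_hasFan (M N : ℕ) (S : Finset V)
    (hN : ∀ l, IsPathList G l → (∀ x ∈ l, x ∈ S) → l.length ≠ N + 1) :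
    S.card ≤ M * fanBound M N ∨ HasFan G M N (fanBound M N) S := by
  by_cases hbig : ∃ K, IsIndecomposable G K ∧ IsClosedIn G K S ∧ fanBound M N < K.card
  · obtain ⟨K, hK, ⟨hKS, hcl⟩, hKc⟩ := hbig
    obtain ⟨u, hu⟩ := hK.1
    have hfan := (card_le_or_hasFan_of_rooted M N K hK hu fun l hl hlK hlen =>
      hN (u :: l) hl (fun x hx => hKS (hlK x hx)) (by rw [List.length_cons, hlen])).resolve_left
        (by omega)
    exact Or.inr (hfan.extend hKS (U := ∅) (by simp) le_rfl (by simp)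
      fun x hx y hy hxy => Or.inl (hcl x hx y hy hxy))
  · push Not at hbig
    by_cases hM : M * fanBound M N < S.card
    · exact Or.inr ((hasFan_of_small_components M S hbig hM).extend subset_rfl (U := ∅)
        (by simp) le_rfl (by simp) fun x hx y hy _ => Or.inl hy)
    · exact Or.inl (by omega)

end Fans

/-! ### Embedding linear forests through a set with many common neighbours -/

section Embedding

variable {V : Type*} {G : SimpleGraph V}

theorem linearForest_isContained {k : ℕ} {p : Fin k → ℕ} (L : Fin k → List V)
    (hL : ∀ i, IsPathList G (L i)) (hlen : ∀ i, (L i).length = p i)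
    (hd : ∀ i j, i ≠ j → ∀ v ∈ L i, v ∉ L j) : (linearForest p).IsContained G := by
  have hlt : ∀ x : (i : Fin k) × Fin (p i), x.2.1 < (L x.1).length := fun x =>
    (hlen x.1).symm ▸ x.2.2
  refine ⟨⟨⟨fun x => (L x.1)[x.2.1]'(hlt x), ?_⟩, ?_⟩⟩
  · rintro _ _ ⟨i, u, v, rfl, rfl, h⟩
    have hc := List.isChain_iff_getElem.1 (hL i).1
    rcases SimpleGraph.pathGraph_adj.1 h with h | h
    · have := hc u.1 (by rw [h]; exact hlt ⟨i, v⟩)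
      simpa [h] using this
    · have := hc v.1 (by rw [h]; exact hlt ⟨i, u⟩)
      simpa [h] using this.symm
  · rintro ⟨i, u⟩ ⟨j, v⟩ h
    change (L i)[u.1]'(hlt ⟨i, u⟩) = (L j)[v.1]'(hlt ⟨j, v⟩) at h
    obtain rfl | hij := eq_or_ne i j
    · have := (List.Nodup.getElem_inj_iff (hL i).2).1 h
      rw [Fin.ext this]
    · exact absurd (h ▸ List.getElem_mem _) (hd i j hij _ (List.getElem_mem (hlt ⟨i, u⟩)))

/-- A long path contains every linear forest of the same size. -/
theorem linearForest_isContained_of_isPathList {k : ℕ} {p : Fin k → ℕ} {l : List V}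
    (hl : IsPathList G l) (hlen : l.length = ∑ i, p i) : (linearForest p).IsContained G := by
  have hlt : ∀ x : (i : Fin k) × Fin (p i), (finSigmaFinEquiv x).1 < l.length := fun x =>
    hlen.symm ▸ (finSigmaFinEquiv x).2
  refine ⟨⟨⟨fun x => l[(finSigmaFinEquiv x).1]'(hlt x), ?_⟩, ?_⟩⟩
  · rintro _ _ ⟨i, u, v, rfl, rfl, h⟩
    have hc := List.isChain_iff_getElem.1 hl.1
    have hu := finSigmaFinEquiv_apply (n := p) ⟨i, u⟩
    have hv := finSigmaFinEquiv_apply (n := p) ⟨i, v⟩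
    dsimp only at hu hv
    rcases SimpleGraph.pathGraph_adj.1 h with h | h
    · have he : (finSigmaFinEquiv (⟨i, u⟩ : (i : Fin k) × Fin (p i))).1 + 1 =
        (finSigmaFinEquiv (⟨i, v⟩ : (i : Fin k) × Fin (p i))).1 := by omega
      have := hc _ (by rw [he]; exact hlt ⟨i, v⟩)
      simpa only [he] using this
    · have he : (finSigmaFinEquiv (⟨i, v⟩ : (i : Fin k) × Fin (p i))).1 + 1 =
        (finSigmaFinEquiv (⟨i, u⟩ : (i : Fin k) × Fin (p i))).1 := by omega
      have := hc _ (by rw [he]; exact hlt ⟨i, u⟩)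
      simpa only [he] using this.symm
  · intro x y h
    have := (List.Nodup.getElem_inj_iff hl.2).1 h
    exact finSigmaFinEquiv.injective (Fin.ext this)

/-- Greedy choice of disjoint paths, where the `j`-th path is allowed to use `x j` vertices
of `A`. -/
theorem exists_disjoint_paths {k : ℕ} {p x : Fin k → ℕ} {A : Finset V} {K : ℕ}
    (h : ∀ j, ∀ F : Finset V, F.card ≤ K → x j ≤ (A \ F).card →
      ∃ l, IsPathList G l ∧ l.length = p j ∧ (∀ v ∈ l, v ∉ F) ∧ (l.toFinset ∩ A).card ≤ x j)
    (J : Finset (Fin k)) (F : Finset V) (hF : F.card + ∑ j ∈ J, p j ≤ K)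
    (hA : ∑ j ∈ J, x j ≤ (A \ F).card) :
    ∃ L : Fin k → List V,
      (∀ j ∈ J, IsPathList G (L j) ∧ (L j).length = p j ∧ ∀ v ∈ L j, v ∉ F) ∧
      ∀ i ∈ J, ∀ j ∈ J, i ≠ j → ∀ v ∈ L i, v ∉ L j := by
  induction J using Finset.induction_on generalizing F with
  | empty => exact ⟨fun _ => [], by simp, by simp⟩
  | insert j J hj ih =>
    rw [Finset.sum_insert hj] at hF hA
    obtain ⟨l, hl, hlen, hlF, hlA⟩ := h j F (by omega) (by omega)
    have hc : (F ∪ l.toFinset).card ≤ F.card + p j := by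
      refine (Finset.card_union_le _ _).trans ?_
      have := l.toFinset_card_le
      omega
    have hA' : ∑ j ∈ J, x j ≤ (A \ (F ∪ l.toFinset)).card := by
      have h1 : A \ (F ∪ l.toFinset) = (A \ F) \ (l.toFinset ∩ A) := by
        ext v
        simp only [Finset.mem_sdiff, Finset.mem_union, Finset.mem_inter]
        tauto
      rw [h1]
      have := Finset.le_card_sdiff (l.toFinset ∩ A) (A \ F)
      omega
    obtain ⟨L, hL1, hL2⟩ := ih (F ∪ l.toFinset) (by omega) hA'
    have hne : ∀ i ∈ J, i ≠ j := fun i hi hij => hj (hij ▸ hi)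
    have hav : ∀ i ∈ J, ∀ v ∈ L i, v ∉ l := fun i hi v hv hvl =>
      (hL1 i hi).2.2 v hv (Finset.mem_union_right _ (List.mem_toFinset.2 hvl))
    refine ⟨Function.update L j l, fun i hi => ?_, fun i hi i' hi' hii' => ?_⟩
    · rcases Finset.mem_insert.1 hi with rfl | hi
      · simpa using ⟨hl, hlen, hlF⟩
      · rw [Function.update_of_ne (hne i hi)]
        exact ⟨(hL1 i hi).1, (hL1 i hi).2.1, fun v hv hvF =>
          (hL1 i hi).2.2 v hv (Finset.mem_union_left _ hvF)⟩
    · rcases Finset.mem_insert.1 hi with h | h <;> rcases Finset.mem_insert.1 hi' with h' | h'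
      · exact absurd (h.trans h'.symm) hii'
      · rw [h, Function.update_self, Function.update_of_ne (hne i' h')]
        exact fun v hv hv' => hav i' h' v hv' hv
      · rw [h', Function.update_self, Function.update_of_ne (hne i h)]
        exact hav i h
      · rw [Function.update_of_ne (hne i h), Function.update_of_ne (hne i' h')]
        exact hL2 i h i' h' hii'

/-- A path alternating between a list of vertices of `A` and common neighbours of `A`, continued
by a given path. -/
theorem exists_alternating_path {A : Finset V} {K : ℕ}
    (hC : ∀ F : Finset V, F.card ≤ K → ∃ c, c ∉ F ∧ c ∉ A ∧ ∀ a ∈ A, G.Adj a c)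
    {Y : List V} (hY : IsPathList G Y) (hYA : ∀ v ∈ Y, v ∉ A)
    (hYh : ∀ c ∈ Y.head?, ∀ a ∈ A, G.Adj a c) (F : Finset V) (α : List V) (a : V)
    (hα : (a :: α).Nodup) (hαA : ∀ v ∈ a :: α, v ∈ A)
    (hK : F.card + 2 * (a :: α).length + Y.length ≤ K) :
    ∃ l, IsPathList G (a :: l) ∧ (a :: l).length + 1 = 2 * (a :: α).length + Y.length ∧
      ∀ v ∈ a :: l, v ∈ a :: α ∨ v ∈ Y ∨ (v ∉ F ∧ v ∉ A) := by
  induction α generalizing a with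
  | nil =>
    refine ⟨Y, isPathList_cons.2 ⟨fun c hc => hYh c hc a (hαA a (by simp)),
      fun h => hYA a h (hαA a (by simp)), hY⟩, by simp; omega, fun v hv => ?_⟩
    rcases List.mem_cons.1 hv with rfl | hv <;> simp_all
  | cons b α ih =>
    obtain ⟨l, hl, hlen, hmem⟩ := ih b hα.of_cons (fun v hv => hαA v (List.mem_cons_of_mem _ hv))
      (by simp only [List.length_cons] at hK ⊢; omega)
    obtain ⟨c, hcF, hcA, hc⟩ := hC (F ∪ (b :: l).toFinset) (by
      have h1 := Finset.card_union_le F (b :: l).toFinset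
      have h2 := (b :: l).toFinset_card_le
      simp only [List.length_cons] at hK hlen h2 ⊢
      omega)
    rw [Finset.mem_union, List.mem_toFinset, not_or] at hcF
    have haA := hαA a (by simp)
    have hbA := hαA b (by simp)
    refine ⟨c :: b :: l, isPathList_cons.2 ⟨by simpa using hc a haA, ?_,
      isPathList_cons.2 ⟨by simpa using (hc b hbA).symm, hcF.2, hl⟩⟩, ?_, ?_⟩
    · rw [List.mem_cons, not_or]
      refine ⟨fun h => hcA (h ▸ haA), fun h => ?_⟩
      rcases hmem a h with h | h | h
      · exact (List.nodup_cons.1 hα).1 h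
      · exact hYA a h haA
      · exact h.2 haA
    · simp only [List.length_cons] at hlen ⊢
      omega
    · intro v hv
      rcases List.mem_cons.1 hv with rfl | hv
      · simp
      rcases List.mem_cons.1 hv with rfl | hv
      · exact Or.inr (Or.inr ⟨hcF.1, hcA⟩)
      · rcases hmem v hv with h | h
        · exact Or.inl (List.mem_cons_of_mem _ h)
        · exact Or.inr h

theorem card_toFinset_inter_le {l α : List V} {A : Finset V} (h : ∀ v ∈ l, v ∈ A → v ∈ α) :
    (l.toFinset ∩ A).card ≤ α.length := by
  refine (Finset.card_le_card fun v hv => ?_).trans α.toFinset_card_le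
  rw [Finset.mem_inter, List.mem_toFinset] at hv
  exact List.mem_toFinset.2 (h v hv.1 hv.2)

/-- Paths through `x` vertices of `A` that begin and end with paths on `m + 1` vertices. -/
theorem exists_path_through {A : Finset V} {K m : ℕ}
    (hY : ∀ F : Finset V, F.card ≤ K → ∃ c Y, IsPathList G (c :: Y) ∧ (c :: Y).length = m + 1 ∧
      (∀ v ∈ c :: Y, v ∉ F ∧ v ∉ A) ∧ ∀ a ∈ A, G.Adj a c)
    (hX : ∀ F : Finset V, F.card ≤ K → ∃ X, IsPathList G X ∧ X.length = 2 * m + 1 ∧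
      ∀ v ∈ X, v ∉ F ∧ v ∉ A)
    {x : ℕ} {F : Finset V} (hF : F.card + 2 * x + 2 * m + 1 ≤ K) (hx : x ≤ (A \ F).card) :
    ∃ l, IsPathList G l ∧ l.length = 2 * x + 2 * m + 1 ∧ (∀ v ∈ l, v ∉ F) ∧
      (l.toFinset ∩ A).card ≤ x := by
  obtain ⟨B, hB, hBx⟩ := Finset.exists_subset_card_eq hx
  have hBl : B.toList.length = x := by rw [Finset.length_toList, hBx]
  have hBm : ∀ v ∈ B.toList, v ∈ A ∧ v ∉ F := fun v hv =>
    Finset.mem_sdiff.1 (hB (Finset.mem_toList.1 hv))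
  have hBn := B.nodup_toList
  -- With `x = 0` there is no vertex of `A` to link two end pieces; the path on `2m + 1` vertices
  -- serves instead.
  rcases hα : B.toList with _ | ⟨a, α⟩
  · obtain ⟨X, hX1, hX2, hX3⟩ := hX F (by omega)
    rw [hα, List.length_nil] at hBl
    subst hBl
    exact ⟨X, hX1, by omega, fun v hv => (hX3 v hv).1,
      card_toFinset_inter_le (α := []) fun v hv hvA => absurd hvA (hX3 v hv).2⟩
  · rw [hα] at hBl hBm hBn
    obtain ⟨c, Y, hY1, hY2, hY3, hY4⟩ := hY F (by omega)
    obtain ⟨l, hl, hlen, hmem⟩ := exists_alternating_path (A := A) (K := K)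
      (fun F hF => by
        obtain ⟨c, Y, -, -, h3, h4⟩ := hY F hF
        exact ⟨c, (h3 c (by simp)).1, (h3 c (by simp)).2, h4⟩)
      hY1 (fun v hv => (hY3 v hv).2) (by simpa using hY4) F α a hBn (fun v hv => (hBm v hv).1)
      (by omega)
    obtain ⟨c', Y', hY1', hY2', hY3', hY4'⟩ := hY (F ∪ (a :: l).toFinset) (by
      have h1 := Finset.card_union_le F (a :: l).toFinset
      have h2 := (a :: l).toFinset_card_le
      omega)
    have haA : a ∈ A := (hBm a (by simp)).1
    refine ⟨(c' :: Y').reverse ++ (a :: l), hY1'.reverse.append hl ?_ ?_, ?_, ?_, ?_⟩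
    · intro v hv hvl
      exact (hY3' v (List.mem_reverse.1 hv)).1
        (Finset.mem_union_right _ (List.mem_toFinset.2 hvl))
    · intro u hu v hv
      rw [List.getLast?_reverse] at hu
      simp only [List.head?_cons, Option.mem_some_iff] at hu hv
      rw [← hu, ← hv]
      exact (hY4' a haA).symm
    · rw [List.length_append, List.length_reverse]
      omega
    · intro v hv
      rcases List.mem_append.1 hv with hv | hv
      · exact fun h => (hY3' v (List.mem_reverse.1 hv)).1 (Finset.mem_union_left _ h)
      · rcases hmem v hv with h | h | h
        exacts [(hBm v h).2, (hY3 v h).1, h.1]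
    · rw [← hBl]
      refine card_toFinset_inter_le fun v hv hvA => ?_
      rcases List.mem_append.1 hv with hv | hv
      · exact absurd hvA (hY3' v (List.mem_reverse.1 hv)).2
      · rcases hmem v hv with h | h | h
        exacts [h, absurd hvA (hY3 v h).2, absurd hvA h.2]

theorem exists_path_through_take {A : Finset V} {K m q : ℕ}
    (hY : ∀ F : Finset V, F.card ≤ K → ∃ c Y, IsPathList G (c :: Y) ∧ (c :: Y).length = m + 1 ∧
      (∀ v ∈ c :: Y, v ∉ F ∧ v ∉ A) ∧ ∀ a ∈ A, G.Adj a c)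
    (hX : ∀ F : Finset V, F.card ≤ K → ∃ X, IsPathList G X ∧ X.length = 2 * m + 1 ∧
      ∀ v ∈ X, v ∉ F ∧ v ∉ A)
    {x : ℕ} (hq : q ≤ 2 * x + 2 * m + 1) (F : Finset V)
    (hF : F.card + 2 * x + 2 * m + 1 ≤ K) (hx : x ≤ (A \ F).card) :
    ∃ l, IsPathList G l ∧ l.length = q ∧ (∀ v ∈ l, v ∉ F) ∧ (l.toFinset ∩ A).card ≤ x := by
  obtain ⟨l, h1, h2, h3, h4⟩ := exists_path_through hY hX hF hx
  refine ⟨l.take q, h1.take q, by rw [List.length_take]; omega,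
    fun v hv => h3 v (List.mem_of_mem_take hv), le_trans (Finset.card_le_card ?_) h4⟩
  refine Finset.inter_subset_inter_right fun v hv => ?_
  rw [List.mem_toFinset] at hv ⊢
  exact List.mem_of_mem_take hv

/-- End pieces on `m + 1` vertices at both ends save `m` vertices of `A` on each component, so `p i
/ 2 - m` of them suffice; truncated subtraction covers components that fit inside a single piece. -/
theorem linearForest_isContained_of_gadgets {k : ℕ} {p : Fin k → ℕ} {A : Finset V} {K m : ℕ}
    (hY : ∀ F : Finset V, F.card ≤ K → ∃ c Y, IsPathList G (c :: Y) ∧ (c :: Y).length = m + 1 ∧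
      (∀ v ∈ c :: Y, v ∉ F ∧ v ∉ A) ∧ ∀ a ∈ A, G.Adj a c)
    (hX : ∀ F : Finset V, F.card ≤ K → ∃ X, IsPathList G X ∧ X.length = 2 * m + 1 ∧
      ∀ v ∈ X, v ∉ F ∧ v ∉ A)
    (hA : ∑ i, (p i / 2 - m) ≤ A.card) (hK : 2 * ∑ i, p i + 2 * m + 1 ≤ K) :
    (linearForest p).IsContained G := by
  have hple : ∀ j, p j ≤ ∑ i, p i := fun j =>
    Finset.single_le_sum (fun i _ => Nat.zero_le (p i)) (Finset.mem_univ j)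
  obtain ⟨L, hL1, hL2⟩ := exists_disjoint_paths (G := G) (p := p) (x := fun i => p i / 2 - m)
    (A := A) (K := ∑ i, p i) (fun j F hF hx =>
      exists_path_through_take hY hX (by omega) F (by have := hple j; omega) hx)
    Finset.univ ∅ (by simp) (by simpa using hA)
  exact linearForest_isContained L (fun i => (hL1 i (Finset.mem_univ i)).1)
    (fun i => (hL1 i (Finset.mem_univ i)).2.1)
    (fun i j => hL2 i (Finset.mem_univ i) j (Finset.mem_univ j))

/-- If `A` has `∑ p i / 2 - 1` vertices with many common neighbours, then a path on `p i` vertices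
that uses less than `p i / 2` vertices of `A` extends to a linear forest. -/
theorem linearForest_isContained_of_saving_path {k : ℕ} {p : Fin k → ℕ} {A : Finset V} {K : ℕ}
    (hC : ∀ F : Finset V, F.card ≤ K → ∃ c, c ∉ F ∧ c ∉ A ∧ ∀ a ∈ A, G.Adj a c)
    (hA : ∑ i, p i / 2 ≤ A.card + 1) (hK : 2 * ∑ i, p i + 1 ≤ K)
    (i : Fin k) {l : List V} (hl : IsPathList G l) (hlen : l.length = p i)
    (hlA : (l.toFinset ∩ A).card + 1 ≤ p i / 2) : (linearForest p).IsContained G := by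
  have hple : ∀ j, p j ≤ ∑ i, p i := fun j =>
    Finset.single_le_sum (fun i _ => Nat.zero_le (p i)) (Finset.mem_univ j)
  have h1 := Finset.add_sum_erase Finset.univ p (Finset.mem_univ i)
  have h2 := Finset.add_sum_erase Finset.univ (fun i => p i / 2) (Finset.mem_univ i)
  have h3 := l.toFinset_card_le
  have h4 : A \ l.toFinset = A \ (l.toFinset ∩ A) := by
    ext v
    simp only [Finset.mem_sdiff, Finset.mem_inter]
    tauto
  have h5 := Finset.le_card_sdiff (l.toFinset ∩ A) A
  obtain ⟨L, hL1, hL2⟩ := exists_disjoint_paths (G := G) (p := p) (x := fun i => p i / 2)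
    (A := A) (K := ∑ i, p i) (fun j F hF hx =>
      -- With `m = 0` the end pieces are single common neighbours, and a path on `p j` vertices
      -- costs `p j / 2` vertices of `A`.
      exists_path_through_take (m := 0) (K := K)
        (fun F hF => by
          obtain ⟨c, h⟩ := hC F hF
          exact ⟨c, [], ⟨by simp, by simp⟩, rfl, by simpa using ⟨h.1, h.2.1⟩, h.2.2⟩)
        (fun F hF => by
          obtain ⟨c, h⟩ := hC F hF
          exact ⟨[c], ⟨by simp, by simp⟩, rfl, by simpa using ⟨h.1, h.2.1⟩⟩)
        (by omega) F (by have := hple j; omega) hx)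
    (Finset.univ.erase i) l.toFinset (by omega) (by rw [h4]; omega)
  have hav : ∀ j, j ≠ i → ∀ v ∈ L j, v ∉ l := fun j hj v hv hvl =>
    (hL1 j (by simpa using hj)).2.2 v hv (List.mem_toFinset.2 hvl)
  refine linearForest_isContained (Function.update L i l) (fun j => ?_) (fun j => ?_) ?_
  · obtain rfl | hj := eq_or_ne j i
    · simpa using hl
    · rw [Function.update_of_ne hj]
      exact (hL1 j (by simpa using hj)).1
  · obtain rfl | hj := eq_or_ne j i
    · simpa using hlen
    · rw [Function.update_of_ne hj]
      exact (hL1 j (by simpa using hj)).2.1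
  · intro j j' hjj'
    obtain hj | hj := eq_or_ne j i <;> obtain hj' | hj' := eq_or_ne j' i
    · exact absurd (hj.trans hj'.symm) hjj'
    · rw [hj, Function.update_self, Function.update_of_ne hj']
      exact fun v hv hv' => hav j' hj' v hv' hv
    · rw [hj', Function.update_self, Function.update_of_ne hj]
      exact hav j hj
    · rw [Function.update_of_ne hj, Function.update_of_ne hj']
      exact hL2 j (by simpa using hj) j' (by simpa using hj') hjj'

end Embedding

/-! ### Finding `L` vertices with many common neighbours -/

section CommonNeighbours

variable {V : Type*} {G : SimpleGraph V}

/-- If every large set contains a small part that meets less than `L` edges per vertex, then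
the graph has essentially less than `L` edges per vertex. -/
theorem adjCount_le_of_sparse_parts {L t n₀ : ℕ}
    (h : ∀ S : Finset V, n₀ < S.card → ∃ R ⊆ S, R.Nonempty ∧ R.card ≤ t ∧
      adjCount G R R + 2 * adjCount G R (S \ R) + 1 ≤ 2 * L * R.card) (S : Finset V) :
    t * adjCount G S S + S.card ≤ 2 * t * L * S.card + (t * n₀ ^ 2 + n₀) := by
  induction S using Finset.strongInduction with
  | H S ih =>
  rcases le_or_gt S.card n₀ with hS | hS
  · have h1 : adjCount G S S ≤ n₀ ^ 2 := (adjCount_self_le S).trans (by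
      rw [sq]; exact Nat.mul_le_mul hS ((Nat.sub_le _ _).trans hS))
    have h2 := Nat.mul_le_mul_left t h1
    omega
  · obtain ⟨R, hRS, hR, hRt, hw⟩ := h S hS
    have h1 := ih (S \ R) (Finset.sdiff_ssubset hRS hR)
    have h2 := adjCount_sdiff_self (G := G) hRS
    have h3 := Finset.card_sdiff_add_card_eq_card hRS
    rw [h2, ← h3]
    -- The deficit of at least `1` for `R`, multiplied by `t ≥ |R|`, pays for the `|R|` vertices
    -- removed.
    have h4 := Nat.mul_le_mul_left t hw
    nlinarith

/-- At least `m + 1` must be saved. A term larger than `m` saves `m`, and any other term, being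
positive, saves at least `1`; this is where two components are needed. -/
theorem sum_tsub_le {k : ℕ} (hk : 2 ≤ k) {a : Fin k → ℕ} (ha : ∀ i, 1 ≤ a i) {d m : ℕ}
    (hm : 1 ≤ m) (hsum : ∑ i, a i = d + m + 1) : ∑ i, (a i - m) ≤ d := by
  by_cases hall : ∀ i, a i ≤ m
  · rw [Finset.sum_eq_zero fun i _ => Nat.sub_eq_zero_of_le (hall i)]
    exact Nat.zero_le d
  · push Not at hall
    obtain ⟨i, hi⟩ := hall
    have : Nontrivial (Fin k) := Fin.nontrivial_iff_two_le.2 hk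
    obtain ⟨j, hj⟩ := exists_ne i
    have hj' : j ∈ Finset.univ.erase i := by simpa using hj
    have h1 := Finset.add_sum_erase Finset.univ a (Finset.mem_univ i)
    have h2 := Finset.add_sum_erase Finset.univ (fun i => a i - m) (Finset.mem_univ i)
    have h3 := Finset.add_sum_erase _ a hj'
    have h4 := Finset.add_sum_erase _ (fun i => a i - m) hj'
    have h5 : ∑ x ∈ (Finset.univ.erase i).erase j, (a x - m) ≤
        ∑ x ∈ (Finset.univ.erase i).erase j, a x :=
      Finset.sum_le_sum fun x _ => Nat.sub_le _ _
    have h6 := ha j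
    omega

/-- Among more than `|F|` disjoint sets, one avoids `F`. -/
theorem exists_disjoint_of_card_lt {ι : Type*} {I : Finset ι} {Q : ι → Finset V}
    (hQ : Pairwise fun i j => Disjoint (Q i) (Q j)) {F : Finset V} (h : F.card < I.card) :
    ∃ j ∈ I, Disjoint (Q j) F := by
  by_contra! hcon
  have hex : ∀ j, ∃ v, j ∈ I → v ∈ Q j ∧ v ∈ F := by
    intro j
    by_cases hj : j ∈ I
    · obtain ⟨v, hv⟩ := Finset.not_disjoint_iff.1 (hcon j hj)
      exact ⟨v, fun _ => hv⟩
    · have hF : I.Nonempty := Finset.card_pos.1 (by omega)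
      obtain ⟨i, hi⟩ := hF
      obtain ⟨v, -⟩ := Finset.not_disjoint_iff.1 (hcon i hi)
      exact ⟨v, fun h => absurd h hj⟩
  choose f hf using hex
  obtain ⟨i, hi, j, hj, hij, he⟩ := Finset.exists_ne_map_eq_of_card_lt_of_maps_to h
    (f := f) (fun j hj => (hf j hj).2)
  exact Finset.disjoint_left.1 (hQ hij) (hf i hi).1 (he ▸ (hf j hj).1)

/-- In a set without sparse parts, a large fan yields either a copy of the linear forest or
`L` vertices with many common neighbours. -/
theorem exists_common_neighbours_of_fan {k : ℕ} (hk : 2 ≤ k) {p : Fin k → ℕ} (hp : ∀ i, 2 ≤ p i)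
    {L : ℕ} (hL : ∑ i, p i / 2 = L + 1) (hfree : (linearForest p).Free G) {M N t K : ℕ}
    {S : Finset V} (hfan : HasFan G M N t S) (hM : 2 ^ N * K < M)
    (hK : 2 * ∑ i, p i + 2 * L + 1 ≤ K)
    (hdense : ∀ R ⊆ S, R.Nonempty → R.card ≤ t →
      2 * L * R.card ≤ adjCount G R R + 2 * adjCount G R (S \ R)) :
    ∃ A C : Finset V, A.card = L ∧ K ≤ C.card ∧ ∀ a ∈ A, ∀ c ∈ C, G.Adj a c := by
  obtain ⟨T, hT, Q, hQ, h⟩ := hfan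
  -- Choosing `v j` with the most neighbours in `T` makes its attachment bound the attachment degree
  -- of all of `Q j`. Pigeonhole over the at most `2 ^ N` subsets of `T` then fixes a common
  -- attachment `A`.
  choose v hvQ hvmax using fun j => Finset.exists_max_image (Q j) (fun x => degIn G x T) (h j).1
  obtain ⟨A, hAT, hA⟩ := Finset.exists_lt_card_fiber_of_mul_lt_card_of_maps_to
    (s := (Finset.univ : Finset (Fin M))) (t := T.powerset) (f := fun j => T.filter (G.Adj (v j)))
    (n := K) (fun j _ => Finset.mem_powerset.2 (Finset.filter_subset _ _)) (by
      rw [Finset.card_powerset, Finset.card_univ, Fintype.card_fin]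
      exact (Nat.mul_le_mul_right K (Nat.pow_le_pow_right (by norm_num) hT)).trans_lt hM)
  set I := Finset.univ.filter fun j => T.filter (G.Adj (v j)) = A with hI
  have hIA : ∀ j ∈ I, T.filter (G.Adj (v j)) = A := fun j hj => (Finset.mem_filter.1 hj).2
  rw [Finset.mem_powerset] at hAT
  have hadj : ∀ j ∈ I, ∀ a ∈ A, G.Adj a (v j) := fun j hj a ha => by
    rw [← hIA j hj, Finset.mem_filter] at ha
    exact ha.2.symm
  rcases le_or_gt L A.card with hLA | hLA
  · obtain ⟨B, hBA, hB⟩ := Finset.exists_subset_card_eq hLA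
    refine ⟨B, I.image v, hB, ?_, fun a ha c hc => ?_⟩
    · rw [Finset.card_image_of_injective]
      · exact hA.le
      · intro i j hij
        by_contra hne
        exact Finset.disjoint_left.1 (hQ hne) (hvQ i) (hij ▸ hvQ j)
    · obtain ⟨j, hj, rfl⟩ := Finset.mem_image.1 hc
      exact hadj j hj a (hBA ha)
  · exfalso
    obtain ⟨m, hm⟩ : ∃ m, L = A.card + m := ⟨L - A.card, by omega⟩
    have hm1 : 1 ≤ m := by omega
    have hdegT : ∀ j ∈ I, ∀ x ∈ Q j, degIn G x T ≤ A.card := fun j hj x hx => by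
      refine (hvmax j x hx).trans (le_of_eq ?_)
      rw [degIn, hIA j hj]
    have hQdeg : ∀ j ∈ I, ∀ x ∈ Q j, m ≤ degIn G x (Q j) := by
      intro j hj x hx
      obtain ⟨h1, h2, h3, h4, h5⟩ := h j
      -- Density of the singleton `{x}` means degree at least `L` in `S`; at most `|A| = L - m` of
      -- these neighbours lie in `T`.
      have hd := hdense {x} (by simpa using h3 hx) (by simp)
        ((Finset.card_le_card (by simpa using hx)).trans h2)
      rw [adjCount_singleton, adjCount_singleton, Finset.card_singleton,
        Finset.sdiff_singleton_eq_erase, degIn_erase_self] at hd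
      have h0 : degIn G x {x} = 0 := degIn_eq_zero.2 (by simp)
      have hs : degIn G x S ≤ degIn G x (Q j ∪ T) := by
        refine Finset.card_le_card fun y hy => ?_
        rw [Finset.mem_filter] at hy ⊢
        exact ⟨Finset.mem_union.2 (h5 x hx y hy.1 hy.2), hy.2⟩
      rw [degIn_union x h4] at hs
      have := hdegT j hj x hx
      omega
    have hQw : ∀ j ∈ I, 2 * m * (Q j).card ≤ adjCount G (Q j) (Q j) := by
      intro j hj
      obtain ⟨h1, h2, h3, h4, h5⟩ := h j
      have hd := hdense (Q j) h3 h1 h2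
      have hs : adjCount G (Q j) (S \ Q j) ≤ (Q j).card * A.card := by
        rw [adjCount, ← smul_eq_mul]
        refine Finset.sum_le_card_nsmul _ _ _ fun x hx =>
          le_trans (Finset.card_le_card fun y hy => ?_) (hdegT j hj x hx)
        rw [Finset.mem_filter, Finset.mem_sdiff] at hy
        exact Finset.mem_filter.2 ⟨(h5 x hx y hy.1.1 hy.2).resolve_left hy.1.2, hy.2⟩
      rw [hm] at hd
      nlinarith
    have havoid : ∀ F : Finset V, F.card ≤ K → ∃ j ∈ I, ∀ x ∈ Q j, x ∉ F ∧ x ∉ A := by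
      intro F hF
      obtain ⟨j, hj, hjF⟩ := exists_disjoint_of_card_lt hQ (hF.trans_lt hA)
      exact ⟨j, hj, fun x hx => ⟨Finset.disjoint_left.1 hjF hx, fun hxA =>
        Finset.disjoint_left.1 (h j).2.2.2.1 hx (hAT hxA)⟩⟩
    refine hfree (linearForest_isContained_of_gadgets (A := A) (K := K) (m := m) ?_ ?_ ?_ ?_)
    · intro F hF
      obtain ⟨j, hj, hav⟩ := havoid F hF
      obtain ⟨Y, h1, h2, h3⟩ := exists_isPathList_head (hQdeg j hj) (hvQ j)
      exact ⟨v j, Y, h1, h3, fun x hx => hav x (h2 x hx), hadj j hj⟩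
    · intro F hF
      obtain ⟨j, hj, hav⟩ := havoid F hF
      obtain ⟨X, h1, h2, h3⟩ := exists_isPathList_of_adjCount hm1 (Q j) (h j).1 (hQw j hj)
      exact ⟨X, h1, h3, fun x hx => hav x (h2 x hx)⟩
    · exact sum_tsub_le hk (fun i => by have := hp i; omega) hm1 (by omega)
    · omega

/-- A large graph without the linear forest and with many edges has `L` vertices with many common
neighbours. -/
theorem exists_common_neighbours {k : ℕ} (hk : 2 ≤ k) {p : Fin k → ℕ} (hp : ∀ i, 2 ≤ p i)
    {L : ℕ} (hL : ∑ i, p i / 2 = L + 1) (K : ℕ) :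
    ∃ n₀, ∀ n ≥ n₀, ∀ G : SimpleGraph (Fin n), (linearForest p).Free G →
      L * (n - L) ≤ G.edgeFinset.card →
      ∃ A C : Finset (Fin n), A.card = L ∧ K ≤ C.card ∧ ∀ a ∈ A, ∀ c ∈ C, G.Adj a c := by
  obtain ⟨N, hN⟩ : ∃ N, ∑ i, p i = N + 1 := by
    refine ⟨∑ i, p i - 1, ?_⟩
    have := Finset.single_le_sum (fun i _ => Nat.zero_le (p i))
      (Finset.mem_univ (⟨0, by omega⟩ : Fin k))
    have := hp ⟨0, by omega⟩
    omega
  set K' := max K (2 * ∑ i, p i + 2 * L + 1) with hK'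
  set M := 2 ^ N * K' + 1 with hM
  set t := fanBound M N
  set b := M * t with hb
  -- Peeling gives `2 t e + n ≤ 2 t L n + t b ^ 2 + b`; with `e ≥ L (n - L)` this forces `n ≤ 2 t L
  -- ^ 2 + t b ^ 2 + b`.
  refine ⟨2 * t * L * L + (t * b ^ 2 + b) + L + 1, fun n hn G hfree hedge => ?_⟩
  by_contra hcon
  have key := adjCount_le_of_sparse_parts (G := G) (L := L) (t := t) (n₀ := b) (fun S hS => by
    by_contra! hno
    have hfan := (card_le_or_hasFan (G := G) M N S fun l hl _ hlen =>
      hfree (linearForest_isContained_of_isPathList hl (hlen.trans hN.symm))).resolve_left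
        (not_le.2 hS)
    obtain ⟨A, C, h1, h2, h3⟩ := exists_common_neighbours_of_fan hk hp hL hfree hfan
      (K := K') (by omega) (le_max_right _ _)
      (fun R hR hRn hRt => Nat.le_of_lt_succ (hno R hR hRn hRt))
    exact hcon ⟨A, C, h1, (le_max_left _ _).trans h2, h3⟩) Finset.univ
  rw [adjCount_univ, Finset.card_univ, Fintype.card_fin] at key
  obtain ⟨r, rfl⟩ : ∃ r, n = L + r := ⟨n - L, by omega⟩
  rw [Nat.add_sub_cancel_left] at hedge
  have h1 := Nat.mul_le_mul_left (2 * t) hedge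
  nlinarith

end CommonNeighbours

/-! ### Edges outside `A` when no path saves a vertex of `A` -/

section EdgeBound

variable {V : Type*} {G : SimpleGraph V}

/-- A path that starts with `W`, alternates between `A` and its common neighbours, and ends
with `Y`. -/
theorem exists_path_joining {A : Finset V} {K : ℕ}
    (hC : ∀ F : Finset V, F.card ≤ K → ∃ c, c ∉ F ∧ c ∉ A ∧ ∀ a ∈ A, G.Adj a c)
    {W Y : List V} (hW : IsPathList G W) (hWA : ∀ v ∈ W, v ∉ A) (hY : IsPathList G Y)
    (hYA : ∀ v ∈ Y, v ∉ A) (hYh : ∀ c ∈ Y.head?, ∀ a ∈ A, G.Adj a c)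
    (hWY : ∀ v ∈ W, v ∉ Y) {a : V} (ha : a ∈ A) (hWa : ∀ w ∈ W.getLast?, G.Adj w a)
    {x : ℕ} (hx : 1 ≤ x) (hxA : x ≤ A.card) (hK : W.length + 2 * x + Y.length ≤ K) :
    ∃ l, IsPathList G l ∧ l.length + 1 = W.length + 2 * x + Y.length ∧
      (l.toFinset ∩ A).card ≤ x := by
  have h1 := Finset.card_erase_add_one ha
  obtain ⟨B, hB, hBx⟩ := Finset.exists_subset_card_eq (show x - 1 ≤ (A.erase a).card by omega)
  have hBl : (a :: B.toList).length = x := by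
    rw [List.length_cons, Finset.length_toList, hBx]
    omega
  have hBA : ∀ v ∈ a :: B.toList, v ∈ A := by
    intro v hv
    rcases List.mem_cons.1 hv with rfl | hv
    · exact ha
    · exact Finset.mem_of_mem_erase (hB (Finset.mem_toList.1 hv))
  obtain ⟨l, hl, hlen, hmem⟩ := exists_alternating_path hC hY hYA hYh W.toFinset B.toList a
    (List.nodup_cons.2 ⟨fun h => by simpa using hB (Finset.mem_toList.1 h), B.nodup_toList⟩)
    hBA (by have := W.toFinset_card_le; omega)
  refine ⟨W ++ (a :: l), hW.append hl ?_ ?_, ?_, ?_⟩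
  · intro v hv hvl
    rcases hmem v hvl with h | h | h
    · exact hWA v hv (hBA v h)
    · exact hWY v hv h
    · exact h.1 (List.mem_toFinset.2 hv)
  · intro w hw y hy
    simp only [List.head?_cons, Option.mem_some_iff] at hy
    exact hy ▸ hWa w hw
  · rw [List.length_append]
    omega
  · rw [← hBl]
    refine card_toFinset_inter_le fun v hv hvA => ?_
    rcases List.mem_append.1 hv with hv | hv
    · exact absurd hvA (hWA v hv)
    · rcases hmem v hv with h | h | h
      exacts [h, absurd hvA (hYA v h), absurd hvA h.2]

theorem half_le_of_sum {k : ℕ} (hk : 2 ≤ k) {p : Fin k → ℕ} (hp : ∀ i, 3 ≤ p i) {L : ℕ}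
    (hL : ∑ i, p i / 2 = L + 1) (i : Fin k) : p i / 2 ≤ L := by
  have : Nontrivial (Fin k) := Fin.nontrivial_iff_two_le.2 hk
  obtain ⟨j, hj⟩ := exists_ne i
  have h1 := Finset.add_sum_erase Finset.univ (fun i => p i / 2) (Finset.mem_univ i)
  have h2 := Finset.single_le_sum (fun i _ => Nat.zero_le (p i / 2))
    (show j ∈ Finset.univ.erase i by simpa using hj)
  have h3 := hp j
  omega

/-- If no path on `p i` vertices meets `A` in less than `p i / 2` vertices, then sets outside `A`
are sparse. -/
theorem adjCount_le_of_no_saving {k : ℕ} (hk : 2 ≤ k) {p : Fin k → ℕ} (hp : ∀ i, 3 ≤ p i) {L : ℕ}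
    (hL : ∑ i, p i / 2 = L + 1) {A : Finset V}
    (hsave : ∀ i l, IsPathList G l → l.length = p i → ¬ (l.toFinset ∩ A).card + 1 ≤ p i / 2)
    {Z : Finset V} (hZ : Disjoint Z A) : adjCount G Z Z ≤ 2 * L * Z.card := by
  by_contra! hlt
  have i : Fin k := ⟨0, by omega⟩
  have h1 := half_le_of_sum hk hp hL i
  have h2 := hp i
  have hne : Z.Nonempty := by
    rw [Finset.nonempty_iff_ne_empty]
    rintro rfl
    simp [adjCount] at hlt
  -- Erdős–Gallai gives `2L + 1` vertices, and `p i ≤ 2 * (p i / 2) + 1 ≤ 2L + 1`.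
  obtain ⟨l, hl, hlZ, hlen⟩ := exists_isPathList_of_adjCount (by omega) Z hne hlt.le
  refine hsave i (l.take (p i)) (hl.take _) (by rw [List.length_take]; omega) ?_
  have : ((l.take (p i)).toFinset ∩ A).card ≤ 0 := card_toFinset_inter_le (α := [])
    fun v hv hvA => absurd hvA (Finset.disjoint_left.1 hZ (hlZ v (List.mem_of_mem_take hv)))
  omega

variable [Fintype V]

/-- An edge outside `A` at a vertex with a neighbour in `A` would start a saving path. Hence
vertices attached to `A` send all their edges, at most `L` each, into `A`, and the others are sparse
by Erdős–Gallai. -/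
theorem adjCount_univ_le_of_even {k : ℕ} (hk : 2 ≤ k) {p : Fin k → ℕ} (hp : ∀ i, 3 ≤ p i) {L : ℕ}
    (hL : ∑ i, p i / 2 = L + 1) {A : Finset V} (hA : A.card = L) {K : ℕ}
    (hK : 2 * L + 5 ≤ K)
    (hC : ∀ F : Finset V, F.card ≤ K → ∃ c, c ∉ F ∧ c ∉ A ∧ ∀ a ∈ A, G.Adj a c)
    (hsave : ∀ i l, IsPathList G l → l.length = p i → ¬ (l.toFinset ∩ A).card + 1 ≤ p i / 2)
    {i : Fin k} (hi : Even (p i)) :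
    adjCount G Finset.univ Finset.univ ≤ adjCount G A A + 2 * L * (Finset.univ \ A).card := by
  set B := Finset.univ \ A with hB
  have hBA : ∀ b ∈ B, b ∉ A := fun b hb => (Finset.mem_sdiff.1 hb).2
  set U := B.filter fun b => ∃ a ∈ A, G.Adj b a with hU
  have hUB : U ⊆ B := Finset.filter_subset _ _
  have hno : ∀ v ∈ U, ∀ b ∈ B, ¬ G.Adj v b := by
    intro v hv b hb hvb
    obtain ⟨hvB, a, ha, hva⟩ := Finset.mem_filter.1 hv
    obtain ⟨c, hc, hcA, hcadj⟩ := hC {v, b} (Finset.card_le_two.trans (by omega))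
    simp only [Finset.mem_insert, Finset.mem_singleton, not_or] at hc
    obtain ⟨s, hs⟩ := hi
    have h1 := hp i
    have h2 := half_le_of_sum hk hp hL i
    -- Two vertices, then `x = p i / 2 - 1` vertices of `A` alternating with outside vertices and
    -- ending in one: `2x + 2 = p i` in all.
    obtain ⟨l, hl, hlen, hlA⟩ := exists_path_joining hC (W := [b, v]) (Y := [c])
      (isPathList_cons.2 ⟨by simpa using hvb.symm, by simpa using hvb.ne', by simp, by simp⟩)
      (by simpa using ⟨hBA b hb, hBA v hvB⟩) ⟨by simp, by simp⟩ (by simpa using hcA)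
      (by simpa using hcadj) (by simpa using ⟨Ne.symm hc.2, Ne.symm hc.1⟩) ha
      (by simpa using hva) (x := p i / 2 - 1) (by omega) (by omega)
      (by simp only [List.length_cons, List.length_nil]; omega)
    simp only [List.length_cons, List.length_nil] at hlen
    exact hsave i l hl (by omega) (by omega)
  have h1 := adjCount_sdiff_self (G := G) (Finset.subset_univ A)
  have h2 := adjCount_sdiff_self (G := G) hUB
  rw [← hB] at h1
  have h3 : adjCount G U U = 0 := adjCount_eq_zero fun v hv b hb => hno v hv b (hUB hb)
  have h4 : adjCount G U (B \ U) = 0 :=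
    adjCount_eq_zero fun v hv b hb => hno v hv b (Finset.sdiff_subset hb)
  have h5 : adjCount G (B \ U) (B \ U) ≤ 2 * L * (B \ U).card :=
    adjCount_le_of_no_saving hk hp hL hsave
      (Finset.disjoint_left.2 fun b hb => hBA b (Finset.sdiff_subset hb))
  have h6 : adjCount G A B ≤ L * U.card := by
    have h7 : adjCount G (B \ U) A = 0 := adjCount_eq_zero fun b hb a ha hba => by
      rw [Finset.mem_sdiff] at hb
      exact hb.2 (Finset.mem_filter.2 ⟨hb.1, a, ha, hba⟩)
    rw [adjCount_comm, ← Finset.union_sdiff_of_subset hUB,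
      adjCount_union_left _ Finset.disjoint_sdiff, h7, add_zero, adjCount, mul_comm,
      ← smul_eq_mul]
    exact Finset.sum_le_card_nsmul _ _ _ fun b _ => hA ▸ degIn_le_card b A
  have h8 := Finset.card_sdiff_add_card_eq_card hUB
  rw [← h8]
  nlinarith

/-- Since `p i ≥ 5`, a saving path still meets `A` and has room for two more outside vertices. So a
vertex outside `A` adjacent to some attached vertex has no other neighbour outside `A`, and an
excess over `L` edges per vertex can arise only on an edge between attached vertices. -/
theorem adjCount_univ_le_of_odd {k : ℕ} (hk : 2 ≤ k) {p : Fin k → ℕ} (hp : ∀ i, 3 ≤ p i) {L : ℕ}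
    (hL : ∑ i, p i / 2 = L + 1) {A : Finset V} (hA : A.card = L) {K : ℕ}
    (hK : 2 * L + 5 ≤ K)
    (hC : ∀ F : Finset V, F.card ≤ K → ∃ c, c ∉ F ∧ c ∉ A ∧ ∀ a ∈ A, G.Adj a c)
    (hsave : ∀ i l, IsPathList G l → l.length = p i → ¬ (l.toFinset ∩ A).card + 1 ≤ p i / 2)
    {i : Fin k} (hi : Odd (p i)) (hi3 : p i ≠ 3) :
    adjCount G Finset.univ Finset.univ ≤
        adjCount G A A + 2 * L * (Finset.univ \ A).card + 1 ∨
      (adjCount G Finset.univ Finset.univ ≤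
        adjCount G A A + 2 * L * (Finset.univ \ A).card + 2 ∧
      ∃ c d, G.Adj c d ∧ ∀ a ∈ A, G.Adj c a ∧ G.Adj d a) := by
  set B := Finset.univ \ A with hB
  have hBA : ∀ b ∈ B, b ∉ A := fun b hb => (Finset.mem_sdiff.1 hb).2
  set U := B.filter fun b => ∃ a ∈ A, G.Adj b a with hU
  have hUB : U ⊆ B := Finset.filter_subset _ _
  have hpi := hp i
  have hpL := half_le_of_sum hk hp hL i
  obtain ⟨s, hs⟩ := hi
  have hpath : ∀ v ∈ U, ∀ b ∈ B, G.Adj v b → ∀ d ∈ B, G.Adj b d → d = v := by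
    intro v hv b hb hvb d hd hbd
    by_contra hdv
    obtain ⟨hvB, a, ha, hva⟩ := Finset.mem_filter.1 hv
    obtain ⟨c, hc, hcA, hcadj⟩ := hC {v, b, d} (Finset.card_le_three.trans (by omega))
    simp only [Finset.mem_insert, Finset.mem_singleton, not_or] at hc
    obtain ⟨l, hl, hlen, hlA⟩ := exists_path_joining hC (W := [d, b, v]) (Y := [c])
      (isPathList_cons.2 ⟨by simpa using hbd.symm, by simpa using ⟨hbd.ne', hdv⟩,
        isPathList_cons.2 ⟨by simpa using hvb.symm, by simpa using hvb.ne', by simp, by simp⟩⟩)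
      (by simpa using ⟨hBA d hd, hBA b hb, hBA v hvB⟩) ⟨by simp, by simp⟩ (by simpa using hcA)
      (by simpa using hcadj)
      (by simpa using ⟨Ne.symm hc.2.2, Ne.symm hc.2.1, Ne.symm hc.1⟩) ha
      (by simpa using hva) (x := p i / 2 - 1) (by omega) (by omega)
      (by simp only [List.length_cons, List.length_nil]; omega)
    simp only [List.length_cons, List.length_nil] at hlen
    exact hsave i l hl (by omega) (by omega)
  have hdeg1 : ∀ b ∈ B, degIn G b U ≤ 1 := by
    intro b hb
    refine Finset.card_le_one.2 fun u hu v hv => ?_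
    rw [Finset.mem_filter] at hu hv
    exact (hpath u hu.1 b hb hu.2.symm v (hUB hv.1) hv.2).symm
  -- Only vertices of `D` can exceed the budget `2L` for twice the degree into `A` plus the degree
  -- in `U`, and only by `1`: a missing neighbour in `A` costs `2`, while the degree in `U` is at
  -- most `1`.
  set D := U.filter fun c => (∀ a ∈ A, G.Adj c a) ∧ degIn G c U ≠ 0 with hD
  have hDadj : ∀ c ∈ D, ∀ d ∈ D, c ≠ d → G.Adj c d := by
    intro c hc d hd hcd
    by_contra hnot
    obtain ⟨hcU, hcA, hc0⟩ := Finset.mem_filter.1 hc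
    obtain ⟨hdU, hdA, hd0⟩ := Finset.mem_filter.1 hd
    rw [Ne, degIn_eq_zero] at hc0 hd0
    push Not at hc0 hd0
    obtain ⟨u, hu, hcu⟩ := hc0
    obtain ⟨v, hv, hdv⟩ := hd0
    obtain ⟨-, a, ha, -⟩ := Finset.mem_filter.1 hcU
    have huv : u ≠ v := by
      rintro rfl
      exact hcd (hpath c hcU u (hUB hu) hcu d (hUB hdU) hdv.symm).symm
    have hud : u ≠ d := by
      rintro rfl
      exact hnot hcu
    have hcv : c ≠ v := by
      rintro rfl
      exact hnot hdv.symm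
    -- Two disjoint edges `uc` and `dv` at the ends of an alternating path give `2x + 3 = p i`
    -- vertices with only `x = p i / 2 - 1` in `A`.
    obtain ⟨l, hl, hlen, hlA⟩ := exists_path_joining hC (W := [u, c]) (Y := [d, v])
      (isPathList_cons.2 ⟨by simpa using hcu.symm, by simpa using hcu.ne', by simp, by simp⟩)
      (by simpa using ⟨hBA u (hUB hu), hBA c (hUB hcU)⟩)
      (isPathList_cons.2 ⟨by simpa using hdv, by simpa using hdv.ne, by simp, by simp⟩)
      (by simpa using ⟨hBA d (hUB hdU), hBA v (hUB hv)⟩)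
      (by simpa using fun a ha => (hdA a ha).symm)
      (by simpa using ⟨⟨hud, huv⟩, hcd, hcv⟩) ha
      (by simpa using hcA a ha) (x := p i / 2 - 1) (by omega) (by omega)
      (by simp only [List.length_cons, List.length_nil]; omega)
    simp only [List.length_cons, List.length_nil] at hlen
    exact hsave i l hl (by omega) (by omega)
  set Z := B \ U with hZ
  set Z₁ := Z.filter fun z => degIn G z U ≠ 0 with hZ₁
  have hZ₁Z : Z₁ ⊆ Z := Finset.filter_subset _ _
  have hZB : Z ⊆ B := Finset.sdiff_subset
  have h1 := adjCount_sdiff_self (G := G) (Finset.subset_univ A)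
  have h2 := adjCount_sdiff_self (G := G) hUB
  have h3 := adjCount_sdiff_self (G := G) hZ₁Z
  rw [← hB] at h1
  rw [← hZ] at h2
  have hZ₁no : ∀ z ∈ Z₁, ∀ y ∈ Z, ¬ G.Adj z y := by
    intro z hz y hy hzy
    obtain ⟨hzZ, hz0⟩ := Finset.mem_filter.1 hz
    rw [Ne, degIn_eq_zero] at hz0
    push Not at hz0
    obtain ⟨u, hu, hzu⟩ := hz0
    have := hpath u hu z (hZB hzZ) hzu.symm y (hZB hy) hzy
    exact (Finset.mem_sdiff.1 hy).2 (this ▸ hu)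
  have h4 : adjCount G Z₁ Z₁ = 0 := adjCount_eq_zero fun z hz y hy => hZ₁no z hz y (hZ₁Z hy)
  have h5 : adjCount G Z₁ (Z \ Z₁) = 0 :=
    adjCount_eq_zero fun z hz y hy => hZ₁no z hz y (Finset.sdiff_subset hy)
  have h6 : adjCount G (Z \ Z₁) (Z \ Z₁) ≤ 2 * L * (Z \ Z₁).card :=
    adjCount_le_of_no_saving hk hp hL hsave
      (Finset.disjoint_left.2 fun b hb => hBA b (hZB (Finset.sdiff_subset hb)))
  have h7 : adjCount G U Z ≤ Z₁.card := by
    rw [adjCount_comm, adjCount, Finset.card_filter]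
    refine Finset.sum_le_sum fun z hz => ?_
    have := hdeg1 z (hZB hz)
    split_ifs with h <;> omega
  have h8 : adjCount G A B = ∑ u ∈ U, degIn G u A := by
    have : adjCount G Z A = 0 := adjCount_eq_zero fun b hb a ha hba =>
      (Finset.mem_sdiff.1 hb).2 (Finset.mem_filter.2 ⟨hZB hb, a, ha, hba⟩)
    rw [adjCount_comm, ← Finset.union_sdiff_of_subset hUB,
      adjCount_union_left _ Finset.disjoint_sdiff, ← hZ, this, add_zero, adjCount]
  have h9 : 2 * adjCount G A B + adjCount G U U ≤ 2 * L * U.card + D.card := by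
    have hDc : D.card =
        ∑ u ∈ U, if (∀ a ∈ A, G.Adj u a) ∧ degIn G u U ≠ 0 then 1 else 0 := by
      rw [hD, Finset.card_filter]
    have hUc : 2 * L * U.card = ∑ u ∈ U, 2 * L := by
      rw [Finset.sum_const, smul_eq_mul, mul_comm]
    rw [h8, adjCount, hDc, hUc, Finset.mul_sum, ← Finset.sum_add_distrib,
      ← Finset.sum_add_distrib]
    refine Finset.sum_le_sum fun u hu => ?_
    have hu1 := hdeg1 u (hUB hu)
    have hu2 := degIn_le_card (G := G) u A
    split_ifs with h
    · omega
    · by_cases hall : ∀ a ∈ A, G.Adj u a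
      · have : degIn G u U = 0 := by
          by_contra h0
          exact h ⟨hall, h0⟩
        omega
      · push Not at hall
        obtain ⟨a, ha, hua⟩ := hall
        have : degIn G u A < A.card :=
          Finset.card_lt_card (Finset.filter_ssubset.2 ⟨a, ha, hua⟩)
        omega
  have h10 := Finset.card_sdiff_add_card_eq_card hUB
  have h11 := Finset.card_sdiff_add_card_eq_card hZ₁Z
  have h12 : 1 ≤ L := by omega
  have h13 : Z₁.card ≤ L * Z₁.card := Nat.le_mul_of_pos_left _ h12
  have h14 : 2 * L * B.card = 2 * L * U.card + 2 * (L * Z₁.card) + 2 * L * (Z \ Z₁).card := by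
    rw [← h10, ← hZ, ← h11]
    ring
  have hmain : adjCount G Finset.univ Finset.univ ≤
      adjCount G A A + 2 * L * B.card + D.card := by omega
  rcases le_or_gt D.card 1 with hD1 | hD1
  · exact Or.inl (by omega)
  · right
    obtain ⟨c, hc, d, hd, hcd⟩ := Finset.one_lt_card.1 hD1
    obtain ⟨hcU, hcA, -⟩ := Finset.mem_filter.1 hc
    obtain ⟨hdU, hdA, -⟩ := Finset.mem_filter.1 hd
    -- `D` is a clique in which every vertex has at most one neighbour, so it has at most two
    -- elements.
    have hD2 : (D.erase c).card ≤ 1 :=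
      (Finset.card_le_card fun y hy => by
        rw [Finset.mem_erase] at hy
        exact Finset.mem_filter.2 ⟨(Finset.mem_filter.1 hy.2).1,
          hDadj c hc y hy.2 hy.1.symm⟩).trans (hdeg1 c (hUB hcU))
    have hD3 := Finset.card_erase_add_one hc
    exact ⟨by omega, c, d, hDadj c hc d hd hcd, fun a ha => ⟨hcA a ha, hdA a ha⟩⟩

end EdgeBound

/-! ### Turán's theorem inside `A` and the upper bounds -/

section UpperBound

variable {V : Type*} {G : SimpleGraph V}

theorem adjCount_self_eq (A : Finset V) [Fintype (G.induce (A : Set V)).edgeSet] :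
    adjCount G A A = 2 * (G.induce (A : Set V)).edgeFinset.card := by
  rw [← adjCount_univ, adjCount, adjCount, ← Finset.sum_coe_sort]
  refine Finset.sum_congr (by ext; simp) fun x _ => ?_
  rw [degIn, degIn, ← Finset.card_map (Function.Embedding.subtype (· ∈ (A : Set V)))]
  congr 1
  ext y
  simp [and_comm]

theorem SimpleGraph.CliqueFree.induce_of_insert {m : ℕ} {A : Finset V} {c : V}
    (h : G.CliqueFree (m + 1)) (hc : ∀ a ∈ A, G.Adj c a) :
    (G.induce (A : Set V)).CliqueFree m := by
  intro t ht
  have h1 := (ht.map (f := Function.Embedding.subtype (· ∈ (A : Set V)))).mono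
    (SimpleGraph.map_comap_le _ G)
  refine h _ (h1.insert (a := c) fun b hb => ?_)
  obtain ⟨x, -, rfl⟩ := Finset.mem_map.1 hb
  exact hc _ x.2

theorem SimpleGraph.CliqueFree.induce_of_insert_two {m : ℕ} {A : Finset V} {c d : V}
    (h : G.CliqueFree (m + 2)) (hcd : G.Adj c d) (hc : ∀ a ∈ A, G.Adj c a ∧ G.Adj d a) :
    (G.induce (A : Set V)).CliqueFree m := by
  intro t ht
  have h1 := (ht.map (f := Function.Embedding.subtype (· ∈ (A : Set V)))).mono
    (SimpleGraph.map_comap_le _ G)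
  have hA : ∀ b ∈ t.map (Function.Embedding.subtype (· ∈ (A : Set V))), b ∈ A := by
    intro b hb
    obtain ⟨x, -, rfl⟩ := Finset.mem_map.1 hb
    exact x.2
  refine h _ ((h1.insert (a := d) fun b hb => (hc b (hA b hb)).2).insert (a := c) fun b hb => ?_)
  rcases Finset.mem_insert.1 hb with rfl | hb
  exacts [hcd, (hc b (hA b hb)).1]

theorem SimpleGraph.CliqueFree.card_edgeFinset_le_turanGraph [Fintype V] [Fintype G.edgeSet]
    {s : ℕ} (h : G.CliqueFree (s + 1)) :
    G.edgeFinset.card ≤ (SimpleGraph.turanGraph (Fintype.card V) s).edgeFinset.card := by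
  rw [SimpleGraph.card_edgeFinset_turanGraph]
  convert h.card_edgeFinset_le

/-- Adding one missing edge raises the clique number by at most one, so the enlarged graph still
obeys the Turán bound. -/
theorem SimpleGraph.CliqueFree.card_edgeFinset_lt_turanGraph [Fintype V] [Fintype G.edgeSet]
    {s : ℕ} (h : G.CliqueFree s) (hs : s ≤ Fintype.card V) :
    G.edgeFinset.card < (SimpleGraph.turanGraph (Fintype.card V) s).edgeFinset.card := by
  have hne : G ≠ ⊤ := by
    rintro rfl
    obtain ⟨t, -, ht⟩ := Finset.exists_subset_card_eq (s := (Finset.univ : Finset V)) (n := s)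
      (by rwa [Finset.card_univ])
    exact h t ⟨fun _ _ _ _ hxy => hxy, ht⟩
  obtain ⟨x, y, hxy, hnot⟩ := SimpleGraph.ne_top_iff_exists_not_adj.1 hne
  have h1 := (h.sup_edge x y).card_edgeFinset_le_turanGraph
  rw [SimpleGraph.card_edgeFinset_sup_edge G hnot hxy] at h1
  have h2 : G.edgeFinset.card + 1 ≤
      (SimpleGraph.turanGraph (Fintype.card V) s).edgeFinset.card := by
    convert h1
  exact h2

/-- If `A` has `L` vertices with many common neighbours, then a graph without the linear forest
has at most `L` edges per vertex outside `A`, apart from one possible exceptional edge. -/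
theorem card_edgeFinset_le_of_common_neighbours [Fintype V] [Fintype G.edgeSet] {k : ℕ}
    (hk : 2 ≤ k) {p : Fin k → ℕ} (hp : ∀ i, 3 ≤ p i) (hP3 : ∃ i, p i ≠ 3) {L : ℕ}
    (hL : ∑ i, p i / 2 = L + 1) (hfree : (linearForest p).Free G) {A C : Finset V}
    (hA : A.card = L) (hCK : 2 * ∑ i, p i + 2 * L + 5 < C.card)
    (hAC : ∀ a ∈ A, ∀ c ∈ C, G.Adj a c) :
    2 * G.edgeFinset.card ≤ 2 * (L * (Fintype.card V - L)) + adjCount G A A + 1 ∨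
      (∀ i, Odd (p i)) ∧
        2 * G.edgeFinset.card ≤ 2 * (L * (Fintype.card V - L)) + adjCount G A A + 2 ∧
        ∃ c d, G.Adj c d ∧ ∀ a ∈ A, G.Adj c a ∧ G.Adj d a := by
  set K := 2 * ∑ i, p i + 2 * L + 5 with hK
  have hC : ∀ F : Finset V, F.card ≤ K → ∃ c, c ∉ F ∧ c ∉ A ∧ ∀ a ∈ A, G.Adj a c := by
    intro F hF
    obtain ⟨c, hc, hcF⟩ := Finset.exists_mem_notMem_of_card_lt_card (show F.card < C.card by omega)
    exact ⟨c, hcF, fun hcA => G.irrefl (hAC c hcA c hc), fun a ha => hAC a ha c hc⟩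
  have hsave : ∀ i l, IsPathList G l → l.length = p i →
      ¬ (l.toFinset ∩ A).card + 1 ≤ p i / 2 := fun i l hl hlen hlA =>
    hfree (linearForest_isContained_of_saving_path hC (by omega) (by omega) i hl hlen hlA)
  have hB : (Finset.univ \ A).card = Fintype.card V - L := by
    rw [Finset.card_sdiff_of_subset (Finset.subset_univ A), hA, Finset.card_univ]
  have hassoc : 2 * L * (Fintype.card V - L) = 2 * (L * (Fintype.card V - L)) := by ring
  by_cases hodd : ∀ i, Odd (p i)
  · obtain ⟨i, hi⟩ := hP3
    rcases adjCount_univ_le_of_odd hk hp hL hA (by omega) hC hsave (hodd i) hi with h | ⟨h, hcd⟩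
    · rw [adjCount_univ, hB, hassoc] at h
      exact Or.inl (by omega)
    · rw [adjCount_univ, hB, hassoc] at h
      exact Or.inr ⟨hodd, by omega, hcd⟩
  · push Not at hodd
    obtain ⟨i, hi⟩ := hodd
    have h := adjCount_univ_le_of_even hk hp hL hA (by omega) hC hsave (Nat.not_odd_iff_even.1 hi)
    rw [adjCount_univ, hB, hassoc] at h
    exact Or.inl (by omega)

theorem exists_card_edgeFinset_le {k : ℕ} (hk : 2 ≤ k) {p : Fin k → ℕ} (hp : ∀ i, 3 ≤ p i)
    (hP3 : ∃ i, p i ≠ 3) {L : ℕ} (hL : ∑ i, p i / 2 = L + 1) :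
    ∃ n₀, ∀ n ≥ n₀, ∀ G : SimpleGraph (Fin n), (linearForest p).Free G →
      (∀ s, s ≤ L → G.CliqueFree (s + 2) →
        G.edgeFinset.card ≤ L * (n - L) + (SimpleGraph.turanGraph L s).edgeFinset.card) ∧
      G.edgeFinset.card ≤ L * (n - L) + L.choose 2 + (if ∀ i, Odd (p i) then 1 else 0) := by
  obtain ⟨n₀, h⟩ := exists_common_neighbours hk (fun i => le_trans (by norm_num) (hp i)) hL
    (2 * ∑ i, p i + 2 * L + 6)
  refine ⟨n₀, fun n hn G hfree => ?_⟩
  by_cases hedge : L * (n - L) ≤ G.edgeFinset.card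
  swap
  · exact ⟨fun s _ _ => by omega, by omega⟩
  obtain ⟨A, C, hA, hCK, hAC⟩ := h n hn G hfree hedge
  have hG := card_edgeFinset_le_of_common_neighbours hk hp hP3 hL hfree hA (by omega) hAC
  obtain ⟨c, hcC⟩ : C.Nonempty := Finset.card_pos.1 (by omega)
  have hcard : Fintype.card (A : Set (Fin n)) = L := by simpa using hA
  rw [Fintype.card_fin, adjCount_self_eq] at hG
  constructor
  · intro s hs hcf
    have h1 := (hcf.induce_of_insert (A := A)
      fun a ha => (hAC a ha c hcC).symm).card_edgeFinset_le_turanGraph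
    rw [hcard] at h1
    -- `adjCount G A A` is even, so a surplus of `1` in the doubled count vanishes on halving. A
    -- surplus of `2` comes with an edge joined to all of `A`, which makes the Turán bound on `A`
    -- strict.
    rcases hG with hG | ⟨-, hG, c', d', hcd, hcd'⟩
    · omega
    · have h2 := (hcf.induce_of_insert_two hcd hcd').card_edgeFinset_lt_turanGraph (by omega)
      rw [hcard] at h2
      omega
  · have h1 := (G.induce (A : Set (Fin n))).card_edgeFinset_le_card_choose_two
    rw [hcard] at h1
    rcases hG with hG | ⟨hodd, hG, -⟩
    · omega
    · rw [if_pos hodd]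
      omega

end UpperBound

/-! ### Joins as extremal graphs -/

section LowerBound

theorem two_mul_card_edgeFinset {V : Type*} [Fintype V] (G : SimpleGraph V) [Fintype G.edgeSet] :
    2 * G.edgeFinset.card = ∑ x, ∑ y, if G.Adj x y then 1 else 0 := by
  rw [← adjCount_univ, adjCount]
  exact Finset.sum_congr rfl fun x _ => Finset.card_filter _ _

/-- The join of two graphs. -/
def graphJoin {α β : Type*} (T : SimpleGraph α) (E : SimpleGraph β) : SimpleGraph (α ⊕ β) :=
  (T ⊕g E) ⊔ completeBipartiteGraph α β

section

variable {α β : Type*} {T : SimpleGraph α} {E : SimpleGraph β}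

theorem graphJoin_adj_inl_inl {x y : α} :
    (graphJoin T E).Adj (Sum.inl x) (Sum.inl y) ↔ T.Adj x y := by
  simp [graphJoin]

theorem graphJoin_adj_inr_inr {x y : β} :
    (graphJoin T E).Adj (Sum.inr x) (Sum.inr y) ↔ E.Adj x y := by
  simp [graphJoin]

theorem graphJoin_adj_inl_inr {x : α} {y : β} :
    (graphJoin T E).Adj (Sum.inl x) (Sum.inr y) := by
  simp [graphJoin]

theorem graphJoin_adj_inr_inl {x : β} {y : α} :
    (graphJoin T E).Adj (Sum.inr x) (Sum.inl y) := by
  simp [graphJoin]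

end

theorem card_edgeFinset_graphJoin {α β : Type*} [Fintype α] [Fintype β] (T : SimpleGraph α)
    (E : SimpleGraph β) [Fintype T.edgeSet] [Fintype E.edgeSet]
    [Fintype (graphJoin T E).edgeSet] :
    (graphJoin T E).edgeFinset.card =
      Fintype.card α * Fintype.card β + T.edgeFinset.card + E.edgeFinset.card := by
  have h := two_mul_card_edgeFinset (graphJoin T E)
  have hT := two_mul_card_edgeFinset T
  have hE := two_mul_card_edgeFinset E
  simp only [Fintype.sum_sum_type, graphJoin_adj_inl_inl, graphJoin_adj_inr_inr,
    graphJoin_adj_inl_inr, graphJoin_adj_inr_inl, if_true, Finset.sum_add_distrib,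
    Finset.sum_const, Finset.card_univ, smul_eq_mul, mul_one] at h
  rw [← hT, ← hE, mul_comm (Fintype.card β)] at h
  omega

theorem SimpleGraph.Colorable.graphJoin {α β : Type*} {T : SimpleGraph α} {E : SimpleGraph β}
    {a b : ℕ} (hT : T.Colorable a) (hE : E.Colorable b) : (graphJoin T E).Colorable (a + b) := by
  obtain ⟨f⟩ := hT
  obtain ⟨g⟩ := hE
  have h := (SimpleGraph.Coloring.mk (G := _root_.graphJoin T E) (Sum.map f g) (by
    rintro (x | x) (y | y) h
    · simpa using f.valid (graphJoin_adj_inl_inl.1 h)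
    · simp
    · simp
    · simpa using g.valid (graphJoin_adj_inr_inr.1 h))).colorable
  simpa using h

theorem SimpleGraph.turanGraph_colorable (n : ℕ) {s : ℕ} (hs : 0 < s) :
    (SimpleGraph.turanGraph n s).Colorable s :=
  ⟨SimpleGraph.Coloring.mk (fun v => ⟨v % s, Nat.mod_lt _ hs⟩) fun {v w} h => by
    simpa using SimpleGraph.turanGraph_adj.1 h⟩

/-- A graph whose edges, up to one exceptional edge when all paths are odd, are covered by less
than `∑ p i / 2` vertices does not contain the linear forest. -/
theorem linearForest_free_of_cover {k : ℕ} {p : Fin k → ℕ} {W : Type*} {G : SimpleGraph W}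
    (A : Finset W) (hA : A.card < ∑ i, p i / 2)
    (hodd : ∀ x ∉ A, ∀ y ∉ A, G.Adj x y → ∀ i, Odd (p i))
    (huniq : ∀ x ∉ A, ∀ y ∉ A, ∀ x' ∉ A, ∀ y' ∉ A, G.Adj x y → G.Adj x' y' →
      s(x, y) = s(x', y')) : (linearForest p).Free G := by
  rintro ⟨f⟩
  have hadj : ∀ i (u v : Fin (p i)), u.1 + 1 = v.1 → G.Adj (f ⟨i, u⟩) (f ⟨i, v⟩) := fun i u v h =>
    f.toHom.map_adj ⟨i, u, v, rfl, rfl, SimpleGraph.pathGraph_adj.2 (Or.inl h)⟩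
  -- The shift `o` selects one of the pairings `{2t, 2t + 1}` and `{2t + 1, 2t + 2}` of the path. If
  -- each had a pair missing `A`, there would be two distinct uncovered edges; the first already
  -- makes `p i` odd, so the shifted pairing fits on the path.
  have key : ∀ i, ∃ o, ∀ t : Fin (p i / 2), ∃ j : Fin (p i), f ⟨i, j⟩ ∈ A ∧
      (j.1 = 2 * t.1 + o ∨ j.1 = 2 * t.1 + o + 1) := by
    intro i
    by_contra! hcon
    obtain ⟨t, ht⟩ := hcon 0
    have htlt := t.2
    set u : Fin (p i) := ⟨2 * t.1, by omega⟩ with hu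
    set v : Fin (p i) := ⟨2 * t.1 + 1, by omega⟩ with hv
    have huA : f ⟨i, u⟩ ∉ A := fun h => (ht u h).1 (by simp [hu])
    have hvA : f ⟨i, v⟩ ∉ A := fun h => (ht v h).2 (by simp [hv])
    have huv := hadj i u v (by simp [hu, hv])
    obtain ⟨q, hq⟩ := hodd _ huA _ hvA huv i
    obtain ⟨t', ht'⟩ := hcon 1
    have htlt' := t'.2
    set u' : Fin (p i) := ⟨2 * t'.1 + 1, by omega⟩ with hu'
    set v' : Fin (p i) := ⟨2 * t'.1 + 2, by omega⟩ with hv'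
    have huA' : f ⟨i, u'⟩ ∉ A := fun h => (ht' u' h).1 (by simp [hu'])
    have hvA' : f ⟨i, v'⟩ ∉ A := fun h => (ht' v' h).2 (by simp [hv'])
    have h := huniq _ huA _ hvA _ huA' _ hvA' huv (hadj i u' v' (by simp [hu', hv']))
    have hinj : ∀ a b : Fin (p i), f ⟨i, a⟩ = f ⟨i, b⟩ → a.1 = b.1 := by
      intro a b hab
      have := f.injective hab
      simp only [Sigma.mk.injEq, heq_eq_eq, true_and] at this
      rw [this]
    rcases Sym2.eq_iff.1 h with ⟨h1, h2⟩ | ⟨h1, h2⟩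
    · have := hinj _ _ h1
      simp only [hu, hu'] at this
      omega
    · have h1 := hinj _ _ h1
      have h2 := hinj _ _ h2
      simp only [hu, hv, hu', hv'] at h1 h2
      omega
  choose o ho using key
  choose j hjA hj using ho
  have hcard : Fintype.card ((i : Fin k) × Fin (p i / 2)) ≤ Fintype.card A := by
    refine Fintype.card_le_of_injective
      (fun x => (⟨f ⟨x.1, j x.1 x.2⟩, hjA x.1 x.2⟩ : A)) ?_
    rintro ⟨i, t⟩ ⟨i', t'⟩ h
    have h1 := f.injective (Subtype.ext_iff.1 h)
    obtain rfl : i = i' := congrArg Sigma.fst h1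
    simp only [Sigma.mk.injEq, heq_eq_eq, true_and] at h1 ⊢
    have h2 := hj i t
    have h3 := hj i t'
    rw [h1] at h2
    exact Fin.ext (by omega)
  rw [Fintype.card_sigma, Fintype.card_coe] at hcard
  simp only [Fintype.card_fin] at hcard
  omega

theorem card_edgeFinset_le_turanNumber {W : Type} [Fintype W] {n : ℕ} (hW : Fintype.card W = n)
    (G : SimpleGraph W) [Fintype G.edgeSet] {𝓕 : Set ((W : Type) × SimpleGraph W)}
    (h : ∀ F ∈ 𝓕, F.2.Free G) : G.edgeFinset.card ≤ turanNumber n 𝓕 := by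
  have e := SimpleGraph.Iso.map (Fintype.equivFinOfCardEq hW) G
  have key : ∀ G : SimpleGraph (Fin n), (∀ F ∈ 𝓕, F.2.Free G) →
      G.edgeFinset.card ≤ turanNumber n 𝓕 := fun G hG =>
    Finset.le_sup (f := fun G : SimpleGraph (Fin n) => G.edgeFinset.card)
      (Finset.mem_filter.2 ⟨Finset.mem_univ G, hG⟩)
  rw [e.card_edgeFinset_eq]
  convert key _ fun F hF => (SimpleGraph.free_congr_right e).1 (h F hF)

theorem turanNumber_le {n b : ℕ} {𝓕 : Set ((W : Type) × SimpleGraph W)}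
    (h : ∀ G : SimpleGraph (Fin n), (∀ F ∈ 𝓕, F.2.Free G) → G.edgeFinset.card ≤ b) :
    turanNumber n 𝓕 ≤ b := by
  refine Finset.sup_le fun G hG => ?_
  simp only [Finset.mem_filter, Finset.mem_univ, true_and] at hG
  exact h G hG

theorem completeGraph_free_iff {V : Type*} {G : SimpleGraph V} {r : ℕ} :
    (SimpleGraph.completeGraph (Fin r)).Free G ↔ G.CliqueFree r := by
  have h := SimpleGraph.cliqueFree_iff_top_free (G := G) (β := Fin r)
  rw [Fintype.card_fin] at h
  exact h.symm

/-- Disjoint palettes colour the join with `a + b < r` colours, which excludes `K_r`; the vertices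
of `T` form the cover that excludes the linear forest. -/
theorem le_turanNumber_of_graphJoin {k : ℕ} {p : Fin k → ℕ} {L M r a b : ℕ}
    (hL : ∑ i, p i / 2 = L + 1) (T : SimpleGraph (Fin L)) (E : SimpleGraph (Fin M))
    [Fintype T.edgeSet] [Fintype E.edgeSet] (hT : T.Colorable a) (hE : E.Colorable b)
    (hab : a + b < r) (hodd : ∀ x y, E.Adj x y → ∀ i, Odd (p i))
    (huniq : ∀ x y x' y', E.Adj x y → E.Adj x' y' → s(x, y) = s(x', y')) :
    L * M + T.edgeFinset.card + E.edgeFinset.card ≤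
      turanNumber (L + M) {⟨Fin r, SimpleGraph.completeGraph (Fin r)⟩, ⟨_, linearForest p⟩} := by
  have hcard := card_edgeFinset_graphJoin T E
  rw [Fintype.card_fin, Fintype.card_fin] at hcard
  rw [← hcard]
  refine card_edgeFinset_le_turanNumber (by simp) _ ?_
  simp only [Set.mem_insert_iff, Set.mem_singleton_iff, forall_eq_or_imp, forall_eq]
  refine ⟨completeGraph_free_iff.2 ((hT.graphJoin hE).cliqueFree hab), ?_⟩
  have hinr : ∀ x : Fin L ⊕ Fin M, x ∉ Finset.univ.map Function.Embedding.inl →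
      ∃ y, x = Sum.inr y := by
    rintro (x | x) h
    · simp at h
    · exact ⟨x, rfl⟩
  refine linearForest_free_of_cover (Finset.univ.map Function.Embedding.inl) (by simp; omega) ?_ ?_
  · intro x hx y hy hxy
    obtain ⟨x, rfl⟩ := hinr x hx
    obtain ⟨y, rfl⟩ := hinr y hy
    exact hodd x y (graphJoin_adj_inr_inr.1 hxy)
  · intro x hx y hy x' hx' y' hy' hxy hxy'
    obtain ⟨x, rfl⟩ := hinr x hx
    obtain ⟨y, rfl⟩ := hinr y hy
    obtain ⟨x', rfl⟩ := hinr x' hx'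
    obtain ⟨y', rfl⟩ := hinr y' hy'
    have := huniq x y x' y' (graphJoin_adj_inr_inr.1 hxy) (graphJoin_adj_inr_inr.1 hxy')
    simpa using congrArg (Sym2.map (Sum.inr (α := Fin L))) this

end LowerBound

/-! ### Matching the bounds -/

section Turan

theorem turanNumber_of_le {k : ℕ} {p : Fin k → ℕ} {L M s : ℕ} (hL : ∑ i, p i / 2 = L + 1)
    (hs : 0 < s)
    (hup : ∀ G : SimpleGraph (Fin (L + M)), (linearForest p).Free G → G.CliqueFree (s + 2) →
      G.edgeFinset.card ≤ L * M + (SimpleGraph.turanGraph L s).edgeFinset.card) :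
    turanNumber (L + M)
      {⟨Fin (s + 2), SimpleGraph.completeGraph (Fin (s + 2))⟩, ⟨_, linearForest p⟩} =
        L * M + (SimpleGraph.turanGraph L s).edgeFinset.card := by
  refine le_antisymm (turanNumber_le fun G hG => ?_) ?_
  · exact hup G (hG ⟨_, linearForest p⟩ (by simp)) (completeGraph_free_iff.1
      (hG ⟨Fin (s + 2), SimpleGraph.completeGraph (Fin (s + 2))⟩ (by simp)))
  · have h := le_turanNumber_of_graphJoin (M := M) (r := s + 2) hL (SimpleGraph.turanGraph L s) ⊥
      (SimpleGraph.turanGraph_colorable L hs) (b := 1)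
      ⟨SimpleGraph.Coloring.mk (fun _ => 0) (by simp)⟩ (by omega) (by simp) (by simp)
    simpa using h

/-- `K_L` joined to a graph with a single edge is `(L + 2)`-colourable, so `r ≥ L + 3` leaves room
for the exceptional edge. -/
theorem le_turanNumber_of_large {k : ℕ} {p : Fin k → ℕ} {L M r : ℕ} (hL : ∑ i, p i / 2 = L + 1)
    (hM : 2 ≤ M) (hr : L + 3 ≤ r) :
    L * M + L.choose 2 + (if ∀ i, Odd (p i) then 1 else 0) ≤
      turanNumber (L + M) {⟨Fin r, SimpleGraph.completeGraph (Fin r)⟩, ⟨_, linearForest p⟩} := by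
  have hT : (⊤ : SimpleGraph (Fin L)).Colorable L := ⟨SimpleGraph.Coloring.mk id (by simp)⟩
  have hc : (⊤ : SimpleGraph (Fin L)).edgeFinset.card = L.choose 2 := by
    rw [SimpleGraph.card_edgeFinset_top_eq_card_choose_two, Fintype.card_fin]
  split_ifs with hodd
  · set x : Fin M := ⟨0, by omega⟩
    set y : Fin M := ⟨1, by omega⟩
    have hxy : x ≠ y := by simp [x, y]
    have hE1 : (SimpleGraph.edge x y).edgeFinset.card = 1 := by
      have := SimpleGraph.card_edgeFinset_sup_edge (⊥ : SimpleGraph (Fin M)) (s := x) (t := y)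
        (by simp) hxy
      have hb : ∀ _ : Fintype (⊥ : SimpleGraph (Fin M)).edgeSet,
          (⊥ : SimpleGraph (Fin M)).edgeFinset.card = 0 := fun _ => by
        rw [Finset.card_eq_zero, SimpleGraph.edgeFinset_eq_empty]
      rw [hb] at this
      simpa using this
    have h := le_turanNumber_of_graphJoin (M := M) (r := r) hL ⊤ (SimpleGraph.edge x y) hT (b := 2)
      ⟨SimpleGraph.Coloring.mk (fun v => if v = x then 0 else 1) (by
        intro v w h
        rw [SimpleGraph.edge_adj] at h
        rcases h.1 with ⟨rfl, rfl⟩ | ⟨rfl, rfl⟩ <;> simp [hxy.symm])⟩ (by omega)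
      (fun _ _ _ => hodd) (by
        intro a b c d h h'
        rw [SimpleGraph.edge_adj] at h h'
        rw [Sym2.eq_iff]
        rcases h.1 with ⟨rfl, rfl⟩ | ⟨rfl, rfl⟩ <;> rcases h'.1 with ⟨rfl, rfl⟩ | ⟨rfl, rfl⟩ <;>
          simp)
    rwa [hc, hE1] at h
  · have h := le_turanNumber_of_graphJoin (M := M) (r := r) hL ⊤ ⊥ hT (b := 1)
      ⟨SimpleGraph.Coloring.mk (fun _ => 0) (by simp)⟩ (by omega) (by simp) (by simp)
    rw [hc] at h
    simpa using h

end Turan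

end LinearForestTuran

/-! ### The three ranges of `r` -/

theorem mainTheorem6 (k : ℕ) (hk : 2 ≤ k) (p : Fin k → ℕ) (hp : ∀ i, 3 ≤ p i)
    (hP3 : ∃ i, p i ≠ 3) (l : ℕ) (hl : l = ∑ i, (p i / 2)) :
    ∀ᶠ n : ℕ in Filter.atTop,
      turanNumber n {⟨Fin 3, SimpleGraph.completeGraph (Fin 3)⟩, ⟨_, linearForest p⟩}
          = (n - l + 1) * (l - 1) ∧
      (∀ r : ℕ, 4 ≤ r → r ≤ l + 1 →
        turanNumber n {⟨Fin r, SimpleGraph.completeGraph (Fin r)⟩, ⟨_, linearForest p⟩}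
          = (n - l + 1) * (l - 1)
            + (SimpleGraph.turanGraph (l - 1) (r - 2)).edgeFinset.card) ∧
      (∀ r : ℕ, l + 2 ≤ r →
        turanNumber n {⟨Fin r, SimpleGraph.completeGraph (Fin r)⟩, ⟨_, linearForest p⟩}
          = (n - l + 1) * (l - 1) + (l - 1).choose 2
            + (if ∀ i, Odd (p i) then 1 else 0)) := by
  have i : Fin k := ⟨0, by omega⟩
  have hi : p i / 2 ≤ ∑ j, p j / 2 :=
    Finset.single_le_sum (fun j _ => Nat.zero_le (p j / 2)) (Finset.mem_univ i)
  have hpi := hp i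
  obtain ⟨L, rfl⟩ : ∃ L, l = L + 1 := ⟨l - 1, by omega⟩
  have hL := hl.symm
  have hL1 := half_le_of_sum hk hp hL i
  obtain ⟨n₀, hn₀⟩ := exists_card_edgeFinset_le hk hp hP3 hL
  -- Beyond the threshold `n₀`, `n ≥ L + 2` provides two vertices outside `A` for the exceptional
  -- edge and keeps the subtraction exact.
  filter_upwards [Filter.eventually_ge_atTop (max n₀ (L + 2))] with n hn
  obtain ⟨M, rfl⟩ : ∃ M, n = L + M := ⟨n - L, by omega⟩
  have hM : (L + M - (L + 1) + 1) * (L + 1 - 1) = L * M := by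
    rw [Nat.add_sub_cancel, mul_comm]
    congr 1
    omega
  have hup := hn₀ (L + M) (le_trans (le_max_left _ _) hn)
  rw [Nat.add_sub_cancel_left] at hup
  rw [hM, Nat.add_sub_cancel]
  -- With `s = r - 2` this covers both (i) and (ii), since `T(L, 1)` has no edges.
  have hmid : ∀ s, 0 < s → s ≤ L → turanNumber (L + M)
      {⟨Fin (s + 2), SimpleGraph.completeGraph (Fin (s + 2))⟩, ⟨_, linearForest p⟩} =
        L * M + (SimpleGraph.turanGraph L s).edgeFinset.card := fun s hs hsL =>
    turanNumber_of_le hL hs fun G hG hcf => (hup G hG).1 s hsL hcf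
  refine ⟨?_, fun r hr hrL => ?_, fun r hr => le_antisymm (turanNumber_le fun G hG => ?_) ?_⟩
  · rw [hmid 1 one_pos (by omega)]
    have h0 : (SimpleGraph.turanGraph L 1).edgeFinset = ∅ := by
      rw [SimpleGraph.edgeFinset_eq_empty]
      ext x y
      simp [SimpleGraph.turanGraph_adj, Nat.mod_one]
    rw [h0, Finset.card_empty, add_zero]
  · obtain ⟨s, rfl⟩ : ∃ s, r = s + 2 := ⟨r - 2, by omega⟩
    exact hmid s (by omega) (by omega)
  · have h := (hup G (hG ⟨_, linearForest p⟩ (by simp))).2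
    convert h
  · have h := le_turanNumber_of_large (M := M) hL (by omega) (by omega : L + 3 ≤ r)
    convert h
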